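/- **Definitions.** A connected simplicial graph $X$ is *quasi-median* if it contains neither $K_4^-$ ($K_4$ minus an edge) nor $K_{3,2}$ as an induced subgraph and satisfies: (triangle condition) for all vertices $a,x,y$ with $x,y$ adjacent and $d(a,x)=d(a,y)$, there is a vertex $z$ adjacent to $x$ and $y$ with $d(a,z)=d(a,x)-1$; (quadrangle condition) for all vertices $a,x,y,z$ with $x\neq y$, $z$ adjacent to $x$ and $y$, and $d(a,x)=d(a,y)=d(a,z)-1$, there is a vertex $w$ adjacent to $x$ and $y$ with $d(a,w)=d(a,z)-2$. A *square* is an induced $4$-cycle, and a *clique* is a maximal complete subgraph. A *hyperplane* is a class of edges for the equivalence relation generated by: two edges are related if they lie in a common triangle or are opposite sides of a square. The *carrier* of a hyperplane is the subgraph generated by its edges, and the *sectors* delimited by $J$ are the connected components of the graph obtained from $X$ by removing the interiors of the edges of $J$. Two hyperplanes $J_1,J_2$ are *transverse* if there are edges $e_1\in J_1$, $e_2\in J_2$ spanning a square; they are *tangent* if they are distinct, not transverse, and their carriers intersect. An action of a group $G$ on a quasi-median graph $X$ by graph automorphisms is *special* if it is faithful and - for every hyperplane $J$ and every $g\in G$,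 $J$ and $gJ$ are neither transverse nor tangent; - for all hyperplanes $J_1,J_2$ and every $g\in G$, if $J_1$ and $J_2$ are transverse then $J_1$ and $gJ_2$ are not tangent; - for every hyperplane $J$, the image of $\mathrm{stab}(J)$ in the permutation group of the set of sectors delimited by $J$ acts freely on this set. Given a simplicial graph $\Gamma$ and groups $\mathcal G=\{G_i \mid i\in V(\Gamma)\}$, the *graph product* $\Gamma\mathcal G$ is the quotient of the free product of the $G_i$ by the normal closure of all commutators $[g,h]$ with $g\in G_i$, $h\in G_j$, $\{i,j\}\in E(\Gamma)$; the $G_i$ are its *vertex-groups*. A subgroup $K\leq A$ is a *virtual retract* if there are a finite-index subgroup $H\leq A$ containing $K$ and a homomorphism $r:H\to K$ with $r|_K=\mathrm{Id}_K$. **Theorem.** Let $G$ be a group which acts specially on a quasi-median graph $X$ with finitely many orbits of vertices. Then there exist a simplicial graph $\Gamma$, a collection $\mathcal G=\{G_i\mid i\in V(\Gamma)\}$ of non-trivial groups such that each $G_i$ contains a finite-index subgroup isomorphic to the (setwise) stabiliser $\mathrm{stab}_G(C)$ of some clique $C$ of $X$, and an injective homomorphism $\varphi:G\hookrightarrow\Gamma\mathcal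 G$ whose image is a virtual retract of $\Gamma\mathcal G$. -/

import Mathlib

open scoped Pointwise

universe u v w

namespace QM

/-! ### Quasi-median graphs -/

/-- The complete graph on four vertices minus an edge. -/
def K4Minus : SimpleGraph (Fin 4) :=
  (⊤ : SimpleGraph (Fin 4)).deleteEdges {s(0, 1)}

/-- Quasi-median graphs. In the quadrangle condition, `x` and `y` are two different vertices. -/
structure IsQuasiMedian {V : Type v} (X : SimpleGraph V) : Prop where
  connected : X.Connected
  no_K4Minus : ¬ K4Minus.IsIndContained X
  no_K32 : ¬ (completeBipartiteGraph (Fin 3) (Fin 2)).IsIndContained X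
  triangle : ∀ a x y : V, X.Adj x y → X.dist a x = X.dist a y →
    ∃ z, X.Adj z x ∧ X.Adj z y ∧ X.dist a z + 1 = X.dist a x
  quadrangle : ∀ a x y z : V, x ≠ y → X.Adj z x → X.Adj z y →
    X.dist a x + 1 = X.dist a z → X.dist a y + 1 = X.dist a z →
    ∃ w, X.Adj w x ∧ X.Adj w y ∧ X.dist a w + 2 = X.dist a z

/-! ### Hyperplanes -/

section Hyperplanes

variable {V : Type v} (X : SimpleGraph V)

/-- `a, b, c, d` are, in this cyclic order, the vertices of a square of `X`, that is, of an
induced cycle of length four. -/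
structure IsSquare (a b c d : V) : Prop where
  adj_ab : X.Adj a b
  adj_bc : X.Adj b c
  adj_cd : X.Adj c d
  adj_da : X.Adj d a
  ne_ac : a ≠ c
  ne_bd : b ≠ d
  not_adj_ac : ¬ X.Adj a c
  not_adj_bd : ¬ X.Adj b d

/-- Two edges are elementarily parallel if they are two sides of a triangle or two opposite
sides of a square. -/
def ElemParallel (e f : Sym2 V) : Prop :=
  (∃ a b c, X.Adj a b ∧ X.Adj b c ∧ X.Adj a c ∧ e = s(a, b) ∧ f = s(b, c)) ∨
  (∃ a b c d, IsSquare X a b c d ∧ e = s(a, b) ∧ f = s(d, c))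

/-- A hyperplane is a class of edges for the equivalence relation generated by `ElemParallel`. -/
def IsHyperplane (J : Set (Sym2 V)) : Prop :=
  ∃ e ∈ X.edgeSet, J = {f | Relation.EqvGen (ElemParallel X) e f}

/-- The vertices of the carrier `N(J)`, the subgraph generated by the edges of `J`. -/
def carrier (J : Set (Sym2 V)) : Set V := {x | ∃ e ∈ J, x ∈ e}

/-- Two hyperplanes are transverse if they contain two (adjacent) sides of a common square. -/
def Transverse (J₁ J₂ : Set (Sym2 V)) : Prop :=
  ∃ a b c d, IsSquare X a b c d ∧ s(a, b) ∈ J₁ ∧ s(b, c) ∈ J₂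

/-- Two hyperplanes are tangent if they are distinct, not transverse, and their carriers
intersect. -/
def Tangent (J₁ J₂ : Set (Sym2 V)) : Prop :=
  J₁ ≠ J₂ ∧ ¬ Transverse X J₁ J₂ ∧ (carrier J₁ ∩ carrier J₂).Nonempty

/-- The sectors delimited by `J`: the connected components of the graph obtained from `X` by
removing the interiors of the edges of `J`. -/
abbrev Sector (J : Set (Sym2 V)) : Type v := (X.deleteEdges J).ConnectedComponent

end Hyperplanes

/-! ### Group actions on graphs -/

section Actions

variable (G : Type u) [Group G] {V : Type v} [MulAction G V] (X : SimpleGraph V)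

/-- The action of `G` on the vertex-set of `X` is an action by graph automorphisms. -/
class ActsOnGraph : Prop where
  adj_smul : ∀ (g : G) (x y : V), X.Adj x y → X.Adj (g • x) (g • y)

/-- The induced action on unordered pairs of vertices. -/
instance sym2MulAction : MulAction G (Sym2 V) where
  smul g e := e.map (g • ·)
  one_smul e := by
    change e.map _ = e
    simp
  mul_smul g h e := by
    change e.map _ = (e.map _).map _
    rw [Sym2.map_map]
    congr 1
    funext x
    exact mul_smul g h x

variable {G}

theorem smul_mk (g : G) (x y : V) : g • s(x, y) = s(g • x, g • y) := rfl

theorem deleteEdges_adj_smul [ActsOnGraph G X] {J : Set (Sym2 V)} {g : G}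
    (hg : g ∈ MulAction.stabilizer G J) {x y : V} (h : (X.deleteEdges J).Adj x y) :
    (X.deleteEdges J).Adj (g • x) (g • y) := by
  rw [SimpleGraph.deleteEdges_adj] at h ⊢
  refine ⟨ActsOnGraph.adj_smul g x y h.1, fun h' => h.2 ?_⟩
  rw [← smul_mk, ← MulAction.mem_stabilizer_iff.1 hg, Set.smul_mem_smul_set_iff] at h'
  exact h'

/-- An element of `stab(J)` induces an endomorphism of the graph obtained from `X` by removing
the interiors of the edges of `J`. -/
def stabHom [ActsOnGraph G X] (J : Set (Sym2 V)) (g : MulAction.stabilizer G J) :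
    X.deleteEdges J →g X.deleteEdges J where
  toFun x := (g : G) • x
  map_rel' h := deleteEdges_adj_smul X g.2 h

/-- The action of `stab(J)` on the sectors delimited by `J`. -/
instance sectorMulAction [ActsOnGraph G X] (J : Set (Sym2 V)) :
    MulAction (MulAction.stabilizer G J) (Sector X J) where
  smul g S := S.map (stabHom X J g)
  one_smul S := by
    induction S using SimpleGraph.ConnectedComponent.ind with
    | h x => exact congrArg (X.deleteEdges J).connectedComponentMk (one_smul G x)
  mul_smul g h S := by
    induction S using SimpleGraph.ConnectedComponent.ind with
    | h x => exact congrArg (X.deleteEdges J).connectedComponentMk (mul_smul (g : G) (h : G) x)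

variable (G)

/-- The image of `stab(J)` in the permutation group of the set of sectors delimited by `J`. -/
def sectorGroup [ActsOnGraph G X] (J : Set (Sym2 V)) : Subgroup (Equiv.Perm (Sector X J)) :=
  (MulAction.toPermHom (MulAction.stabilizer G J) (Sector X J)).range

/-- Special actions: the action is faithful; a hyperplane and its translates are neither
transverse nor tangent; if `J₁` and `J₂` are transverse then `J₁` and `g J₂` are not tangent; and
the image of `stab(J)` in the permutation group of the sectors of `J` acts freely on them. -/
structure IsSpecialAction [ActsOnGraph G X] : Prop where
  faithful : FaithfulSMul G V
  not_transverse_smul : ∀ J, IsHyperplane X J → ∀ g : G, ¬ Transverse X J (g • J)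
  not_tangent_smul : ∀ J, IsHyperplane X J → ∀ g : G, ¬ Tangent X J (g • J)
  not_tangent_of_transverse : ∀ J₁ J₂, IsHyperplane X J₁ → IsHyperplane X J₂ → ∀ g : G,
    Transverse X J₁ J₂ → ¬ Tangent X J₁ (g • J₂)
  free_sectors : ∀ J, IsHyperplane X J → ∀ σ ∈ sectorGroup G X J, ∀ S : Sector X J,
    σ S = S → σ = 1

end Actions

/-! ### Graph products and virtual retracts -/

section Groups

/-- The commutators which are killed in a graph product. -/
def graphProductRelators {I : Type v} (Γ : SimpleGraph I) (𝒢 : I → Type w)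
    [∀ i, Group (𝒢 i)] : Set (Monoid.CoprodI 𝒢) :=
  {r | ∃ i j, Γ.Adj i j ∧ ∃ (g : 𝒢 i) (h : 𝒢 j),
    r = Monoid.CoprodI.of g * Monoid.CoprodI.of h *
      (Monoid.CoprodI.of g)⁻¹ * (Monoid.CoprodI.of h)⁻¹}

/-- The graph product of the groups `𝒢 i` over the simplicial graph `Γ`. -/
abbrev GraphProduct {I : Type v} (Γ : SimpleGraph I) (𝒢 : I → Type w)
    [∀ i, Group (𝒢 i)] : Type (max v w) :=
  Monoid.CoprodI 𝒢 ⧸ Subgroup.normalClosure (graphProductRelators Γ 𝒢)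

/-- `K` is a virtual retract of `A`: it is a retract of a finite-index subgroup of `A`. -/
def IsVirtualRetract {A : Type w} [Group A] (K : Subgroup A) : Prop :=
  ∃ H : Subgroup A, H.FiniteIndex ∧ ∃ hKH : K ≤ H, ∃ r : H →* K,
    ∀ k : K, r (Subgroup.inclusion hKH k) = k

/-- `E` contains a copy of `S` as a finite-index subgroup. -/
def IsFiniteExtension (E : Type w) [Group E] (S : Type u) [Group S] : Prop :=
  ∃ f : S →* E, Function.Injective f ∧ f.range.FiniteIndex

end Groups

end QM

/-! The sectors of hyperplanes are coloured by groups. If `K` is the image of `stab(J)` in the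
permutations of the sectors of `J`, then the sectors form a free `K`-set with finitely many orbits,
say `n`. They are therefore in bijection with `K × ZMod n`, with `stab(J)` acting by left
translations. Transporting this colouring along the orbit of `J` gives one group `B i` per orbit `i`
of hyperplanes. The graph `Γ` has these orbits as vertices, adjacent when they contain transverse
hyperplanes.

A vertex `x` lies in the carrier of at most one `J` of class `i`. An element `a : B i` moves `x`
inside its `J`-clique to the vertex whose colour is that of `x` times `a⁻¹`, and fixes `x` if there
is no such `J`. Right translations of colours commute with left ones, so the moves commute with `G`.
Moves of adjacent classes commute because the corresponding edges at `x` span a square. Thus the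
graph product acts on the vertices, commuting with `G`.

Conversely, label an oriented edge by the element of `B i` that moves its origin to its end. Labels
are `G`-invariant and compatible with triangles and squares, so the product `F x` of labels along a
path from `x₀` to `x` depends on `x` only. Then `g ↦ F (g⁻¹ • x₀)` is a homomorphism. The elements
sending `x₀` into `G • x₀` form a finite-index subgroup, since its cosets inject into the `G`-orbits
of vertices. It retracts onto the image because `G` acts freely on vertices.

The geometry enters through `IsGate.eqvGen_of_adj` (distinct vertices of a clique of `J` lie in
distinct sectors), `IsHyperplane.exists_mem_clique_reachable` (every sector meets every clique of
`J`) and `Transverse.exists_square` (transversality is visible at each common vertex of the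
carriers). -/

namespace QM

/-! ### Parallel edges and hyperplanes -/

section Geometry

variable {V : Type v} {X : SimpleGraph V}

theorem IsQuasiMedian.dist_le_succ (hX : IsQuasiMedian X) (a : V) {x y : V} (h : X.Adj x y) :
    X.dist a y ≤ X.dist a x + 1 := by
  have h1 := hX.connected.dist_triangle (u := a) (v := x) (w := y)
  rwa [SimpleGraph.dist_eq_one_iff_adj.2 h] at h1

/-- Otherwise the four vertices induce a copy of `K4Minus` whose missing edge is `cd`. -/
theorem IsQuasiMedian.adj_of_common_edge (hX : IsQuasiMedian X) {a b c d : V} (hab : X.Adj a b)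
    (hac : X.Adj a c) (hbc : X.Adj b c) (had : X.Adj a d) (hbd : X.Adj b d) (hcd : c ≠ d) :
    X.Adj c d := by
  by_contra hn
  refine hX.no_K4Minus ⟨⟨⟨![c, d, a, b], ?_⟩, ?_⟩⟩
  · intro i j hij
    fin_cases i <;> fin_cases j <;>
      simp_all [hcd.symm, hab.ne, hac.ne, hbc.ne, had.ne, hbd.ne, hab.ne', hac.ne', hbc.ne',
        had.ne', hbd.ne']
  · intro i j
    change X.Adj (![c, d, a, b] i) (![c, d, a, b] j) ↔ K4Minus.Adj i j
    fin_cases i <;> fin_cases j <;>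
      simp [K4Minus, hn, hab, hac, hbc, had, hbd, hab.symm, hac.symm, hbc.symm, had.symm,
        hbd.symm, mt SimpleGraph.Adj.symm hn]

theorem IsSquare.rotate {a b c d : V} (h : IsSquare X a b c d) : IsSquare X b c d a :=
  ⟨h.adj_bc, h.adj_cd, h.adj_da, h.adj_ab, h.ne_bd, h.ne_ac.symm, h.not_adj_bd,
    fun h' => h.not_adj_ac h'.symm⟩

theorem IsSquare.reflect {a b c d : V} (h : IsSquare X a b c d) : IsSquare X a d c b :=
  ⟨h.adj_da.symm, h.adj_cd.symm, h.adj_bc.symm, h.adj_ab.symm, h.ne_ac, h.ne_bd.symm,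
    h.not_adj_ac, fun h' => h.not_adj_bd h'.symm⟩

theorem Transverse.symm {J₁ J₂ : Set (Sym2 V)} (h : Transverse X J₁ J₂) : Transverse X J₂ J₁ := by
  obtain ⟨a, b, c, d, h, h1, h2⟩ := h
  refine ⟨c, b, a, d, h.rotate.rotate.reflect, ?_, ?_⟩ <;> rwa [Sym2.eq_swap]

theorem ElemParallel.symm {e f : Sym2 V} (h : ElemParallel X e f) : ElemParallel X f e := by
  rcases h with ⟨a, b, c, hab, hbc, hac, rfl, rfl⟩ | ⟨a, b, c, d, h, rfl, rfl⟩
  · exact Or.inl ⟨c, b, a, hbc.symm, hab.symm, hac.symm, Sym2.eq_swap, Sym2.eq_swap⟩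
  · exact Or.inr ⟨d, c, b, a, h.reflect.rotate, rfl, rfl⟩

theorem ElemParallel.mem_edgeSet {e f : Sym2 V} (h : ElemParallel X e f) : f ∈ X.edgeSet := by
  rcases h with ⟨a, b, c, hab, hbc, hac, rfl, rfl⟩ | ⟨a, b, c, d, h, rfl, rfl⟩
  · exact hbc
  · exact h.adj_cd.symm

variable {J J₁ J₂ : Set (Sym2 V)}

theorem IsHyperplane.mem_of_elemParallel (hJ : IsHyperplane X J) {e f : Sym2 V} (he : e ∈ J)
    (h : ElemParallel X e f) : f ∈ J := by
  obtain ⟨e₀, -, rfl⟩ := hJ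
  exact Relation.EqvGen.trans _ _ _ he (Relation.EqvGen.rel _ _ h)

theorem IsHyperplane.eqvGen (hJ : IsHyperplane X J) {e f : Sym2 V} (he : e ∈ J) (hf : f ∈ J) :
    Relation.EqvGen (ElemParallel X) e f := by
  obtain ⟨e₀, -, rfl⟩ := hJ
  exact Relation.EqvGen.trans _ _ _ (Relation.EqvGen.symm _ _ he) hf

theorem IsHyperplane.mem_of_eqvGen (hJ : IsHyperplane X J) {e f : Sym2 V} (he : e ∈ J)
    (h : Relation.EqvGen (ElemParallel X) e f) : f ∈ J := by
  obtain ⟨e₀, -, rfl⟩ := hJ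
  exact Relation.EqvGen.trans _ _ _ he h

theorem IsHyperplane.eq_of_mem (h₁ : IsHyperplane X J₁) (h₂ : IsHyperplane X J₂) {e : Sym2 V}
    (he₁ : e ∈ J₁) (he₂ : e ∈ J₂) : J₁ = J₂ :=
  Set.ext fun _ => ⟨fun hf => h₂.mem_of_eqvGen he₂ (h₁.eqvGen he₁ hf),
    fun hf => h₁.mem_of_eqvGen he₁ (h₂.eqvGen he₂ hf)⟩

theorem IsHyperplane.induction (hJ : IsHyperplane X J) {p : Sym2 V → Prop} {e : Sym2 V}
    (he : e ∈ J) (h0 : p e)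
    (hstep : ∀ e f, e ∈ J → ElemParallel X e f → p e → p f) {f : Sym2 V} (hf : f ∈ J) : p f := by
  suffices H : ∀ e f, Relation.EqvGen (ElemParallel X) e f → e ∈ J → (p e ↔ p f) from
    (H e f (hJ.eqvGen he hf) he).1 h0
  intro e f h
  induction h with
  | rel e f h =>
    exact fun he => ⟨hstep e f he h, hstep f e (hJ.mem_of_elemParallel he h) h.symm⟩
  | refl e => exact fun _ => Iff.rfl
  | symm e f h ih =>
    exact fun hf => (ih (hJ.mem_of_eqvGen hf (Relation.EqvGen.symm _ _ h))).symm
  | trans e f g h _ ih1 ih2 => exact fun he => (ih1 he).trans (ih2 (hJ.mem_of_eqvGen he h))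

theorem IsHyperplane.mem_edgeSet (hJ : IsHyperplane X J) {e : Sym2 V} (he : e ∈ J) :
    e ∈ X.edgeSet := by
  obtain ⟨e₀, h₀, rfl⟩ := hJ
  exact IsHyperplane.induction (J := {f | Relation.EqvGen (ElemParallel X) e₀ f})
    ⟨e₀, h₀, rfl⟩ (Relation.EqvGen.refl e₀) h₀ (fun _ _ _ h _ => h.mem_edgeSet) he

theorem IsHyperplane.adj (hJ : IsHyperplane X J) {x y : V} (h : s(x, y) ∈ J) : X.Adj x y :=
  hJ.mem_edgeSet h

theorem IsHyperplane.mem_of_triangle (hJ : IsHyperplane X J) {a b c : V} (h : s(a, b) ∈ J)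
    (hac : X.Adj a c) (hbc : X.Adj b c) : s(b, c) ∈ J :=
  hJ.mem_of_elemParallel h (Or.inl ⟨a, b, c, hJ.adj h, hbc, hac, rfl, rfl⟩)

theorem IsHyperplane.mem_of_square (hJ : IsHyperplane X J) {a b c d : V} (h : s(a, b) ∈ J)
    (hs : IsSquare X a b c d) : s(d, c) ∈ J :=
  hJ.mem_of_elemParallel h (Or.inr ⟨a, b, c, d, hs, rfl, rfl⟩)

/-! ### Maximal cliques and gates -/

/-- The common neighbours of the ends of an edge are pairwise adjacent, so together with the edge
they form its only maximal clique. -/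
theorem exists_maximal_clique (hX : IsQuasiMedian X) {x y : V} (h : X.Adj x y) :
    ∃ C : Set V, Maximal X.IsClique C ∧ x ∈ C ∧ y ∈ C := by
  refine ⟨{z | z = x ∨ z = y ∨ (X.Adj x z ∧ X.Adj y z)}, ⟨?_, ?_⟩, Or.inl rfl, Or.inr (Or.inl rfl)⟩
  · rintro a (rfl | rfl | ⟨ha1, ha2⟩) b (rfl | rfl | ⟨hb1, hb2⟩) hab
    · exact absurd rfl hab
    · exact h
    · exact hb1
    · exact h.symm
    · exact absurd rfl hab
    · exact hb2
    · exact ha1.symm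
    · exact ha2.symm
    · exact hX.adj_of_common_edge h ha1 ha2 hb1 hb2 hab
  · intro D hD hCD z hz
    by_cases hzx : z = x
    · exact Or.inl hzx
    by_cases hzy : z = y
    · exact Or.inr (Or.inl hzy)
    · exact Or.inr (Or.inr ⟨hD (hCD (Or.inl rfl)) hz (Ne.symm hzx),
        hD (hCD (Or.inr (Or.inl rfl))) hz (Ne.symm hzy)⟩)

variable {C : Set V}

theorem mem_of_adj_adj (hX : IsQuasiMedian X) (hC : Maximal X.IsClique C) {a b z : V} (ha : a ∈ C)
    (hb : b ∈ C) (hab : a ≠ b) (hza : X.Adj z a) (hzb : X.Adj z b) : z ∈ C := by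
  refine hC.2 (y := insert z C) ?_ (Set.subset_insert _ _) (Set.mem_insert _ _)
  refine SimpleGraph.isClique_insert.2 ⟨hC.1, fun c hc hzc => ?_⟩
  by_cases hca : a = c
  · exact hca ▸ hza
  by_cases hcb : b = c
  · exact hcb ▸ hzb
  · exact hX.adj_of_common_edge (hC.1 ha hb hab) hza.symm hzb.symm (hC.1 ha hc hca)
      (hC.1 hb hc hcb) hzc

/-- `c` is the gate of `u` in the clique `C`. -/
def IsGate (X : SimpleGraph V) (C : Set V) (u c : V) : Prop :=
  c ∈ C ∧ ∀ c' ∈ C, c' ≠ c → X.dist u c' = X.dist u c + 1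

/-- Two vertices of `C` both nearest to `u` would have, by the triangle condition, a common
neighbour strictly nearer to `u`, and maximality would put it in `C`. -/
theorem exists_isGate (hX : IsQuasiMedian X) (hC : Maximal X.IsClique C) (hne : C.Nonempty)
    (u : V) : ∃ c, IsGate X C u c := by
  obtain ⟨c, hc, hmin⟩ : ∃ c ∈ C, ∀ c' ∈ C, X.dist u c ≤ X.dist u c' :=
    ⟨_, Function.argminOn_mem (X.dist u) C hne, fun c' hc' => Function.argminOn_le (X.dist u) C hc'⟩
  refine ⟨c, hc, fun c' hc' hne' => ?_⟩
  have hadj := hC.1 hc hc' hne'.symm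
  have h1 := hX.dist_le_succ u hadj
  have h2 := hmin c' hc'
  by_contra hcon
  obtain ⟨z, hz1, hz2, hz3⟩ := hX.triangle u c c' hadj (by omega)
  have := hmin z (mem_of_adj_adj hX hC hc hc' hne'.symm hz1 hz2)
  omega

theorem isGate_self (hC : X.IsClique C) {c : V} (hc : c ∈ C) : IsGate X C c c := by
  refine ⟨hc, fun c' hc' hne => ?_⟩
  rw [SimpleGraph.dist_self, SimpleGraph.dist_eq_one_iff_adj.2 (hC hc hc' hne.symm)]

theorem IsGate.dist_eq_of_adj (hX : IsQuasiMedian X) {u v c c' : V} (hu : IsGate X C u c)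
    (hv : IsGate X C v c') (hne : c ≠ c') (h : X.Adj u v) : X.dist u c = X.dist v c' := by
  have h1 := hu.2 c' hv.1 hne.symm
  have h2 := hv.2 c hu.1 hne
  have h3 := hX.dist_le_succ c h
  have h4 := hX.dist_le_succ c' h.symm
  simp only [SimpleGraph.dist_comm (u := u), SimpleGraph.dist_comm (u := v)] at *
  omega

theorem exists_adj_dist_eq (hX : IsQuasiMedian X) {a x : V} {n : ℕ} (h : X.dist a x = n + 1) :
    ∃ y, X.Adj y x ∧ X.dist a y = n := by
  obtain ⟨p, hp⟩ := hX.connected.exists_walk_length_eq_dist x a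
  cases p with
  | nil => simp at h
  | cons hxy q =>
    rename_i y
    refine ⟨y, hxy.symm, ?_⟩
    have h1 := SimpleGraph.dist_le q
    have h2 := hX.dist_le_succ a hxy.symm
    rw [SimpleGraph.Walk.length_cons] at hp
    simp only [SimpleGraph.dist_comm (v := a)] at *
    omega

theorem isGate_of_dist_lt (hX : IsQuasiMedian X) (hC : Maximal X.IsClique C) {u c c' : V}
    (hc : c ∈ C) (hc' : c' ∈ C) (h : X.dist u c < X.dist u c') : IsGate X C u c := by
  obtain ⟨b, hb⟩ := exists_isGate hX hC ⟨c, hc⟩ u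
  by_cases h0 : c = b
  · exact h0 ▸ hb
  · have e1 := hb.2 c hc h0
    by_cases e : c' = b
    · subst e
      omega
    · have := hb.2 c' hc' e
      omega

/-- Induction on the distance to `C`. Let `u'` follow `u` on a geodesic to `c`. The quadrangle
condition based at `c'` closes a square `u v w u'`, in which `u'w` is opposite to `uv`, one step
nearer to `C`, and has the same pair of gates. -/
theorem IsGate.eqvGen_of_adj (hX : IsQuasiMedian X) (hC : Maximal X.IsClique C) {c c' : V}
    (hne : c ≠ c') {n : ℕ} {u v : V} (hu : IsGate X C u c) (hv : IsGate X C v c')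
    (h : X.Adj u v) (hn : X.dist u c = n) :
    Relation.EqvGen (ElemParallel X) s(c, c') s(u, v) := by
  induction n generalizing u v with
  | zero =>
    have hv' := hu.dist_eq_of_adj hX hv hne h
    rw [hn] at hv'
    rw [(hX.connected.preconnected u c).dist_eq_zero_iff.1 hn,
      (hX.connected.preconnected v c').dist_eq_zero_iff.1 hv'.symm]
    exact Relation.EqvGen.refl _
  | succ n ih =>
    have hd := hu.dist_eq_of_adj hX hv hne h
    have h1 := hu.2 c' hv.1 hne.symm
    have h2 := hv.2 c hu.1 hne
    obtain ⟨u', hu'u, hu'⟩ := exists_adj_dist_eq hX (SimpleGraph.dist_comm.trans hn)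
    have h3 := hX.dist_le_succ c' hu'u
    have hcc' : X.dist c c' = 1 := SimpleGraph.dist_eq_one_iff_adj.2 (hC.1 hu.1 hv.1 hne)
    have h4 := hX.connected.dist_triangle (u := c') (v := c) (w := u')
    rw [SimpleGraph.dist_comm (u := c') (v := c)] at h4
    rw [SimpleGraph.dist_comm (v := c)] at hn hd h1 h2
    rw [SimpleGraph.dist_comm (v := c')] at hd h1 h2
    have hne' : u' ≠ v := by
      rintro rfl
      omega
    obtain ⟨w, hwu', hwv, hw⟩ := hX.quadrangle c' u' v u hne' hu'u.symm h (by omega) (by omega)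
    have h7 := hX.dist_le_succ c hwv
    have h8 := hX.dist_le_succ c hwu'.symm
    have hsq : IsSquare X u v w u' := by
      refine ⟨h, hwv.symm, hwu', hu'u, ?_, hne'.symm, fun h' => ?_, fun h' => ?_⟩
      · rintro rfl
        omega
      · have := hX.dist_le_succ c' h'.symm
        omega
      · have := hX.dist_le_succ c h'.symm
        omega
    have hgu' : IsGate X C u' c := isGate_of_dist_lt hX hC hu.1 hv.1 (by
      rw [SimpleGraph.dist_comm, SimpleGraph.dist_comm (v := c')]; omega)
    have hgw : IsGate X C w c' := isGate_of_dist_lt hX hC hv.1 hu.1 (by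
      rw [SimpleGraph.dist_comm, SimpleGraph.dist_comm (v := c)]; omega)
    have := ih hgu' hgw hwu'.symm (by rw [SimpleGraph.dist_comm]; exact hu')
    refine Relation.EqvGen.trans _ _ _ this (Relation.EqvGen.rel _ _ ?_)
    exact ElemParallel.symm (Or.inr ⟨u, v, w, u', hsq, rfl, rfl⟩)

end Geometry

/-! ### Sectors delimited by a hyperplane -/

section Sectors

variable {V : Type v} {X : SimpleGraph V} {J J₁ J₂ : Set (Sym2 V)} {C : Set V}

theorem reachable_deleteEdges {x y : V} (h : X.Adj x y) (hJ : s(x, y) ∉ J) :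
    (X.deleteEdges J).Reachable x y :=
  SimpleGraph.Adj.reachable (SimpleGraph.deleteEdges_adj.2 ⟨h, hJ⟩)

theorem IsHyperplane.mem_of_mem_clique (hJ : IsHyperplane X J) (hC : X.IsClique C) {x y c c' : V}
    (hxy : s(x, y) ∈ J) (hx : x ∈ C) (hy : y ∈ C) (hc : c ∈ C) (hc' : c' ∈ C) (hne : c ≠ c') :
    s(c, c') ∈ J := by
  have key : ∀ a b c, a ∈ C → b ∈ C → c ∈ C → s(a, b) ∈ J → b ≠ c → s(b, c) ∈ J := by
    intro a b c ha hb hc hab hbc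
    by_cases hac : a = c
    · rw [← hac, Sym2.eq_swap]
      exact hab
    · exact hJ.mem_of_triangle hab (hC ha hc hac) (hC hb hc hbc)
  by_cases h : y = c
  · subst h
    exact key x y c' hx hy hc' hxy hne
  · exact key y c c' hy hc hc' (key x y c hx hy hc hxy h) hne

/-- An edge along which the gate changes is parallel to an edge of `C`, hence belongs to `J`. A path
avoiding `J` therefore keeps its gate. -/
theorem IsGate.of_reachable (hX : IsQuasiMedian X) (hJ : IsHyperplane X J)
    (hC : Maximal X.IsClique C) {x y : V} (hxy : s(x, y) ∈ J) (hx : x ∈ C) (hy : y ∈ C) {u v c : V}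
    (h : (X.deleteEdges J).Reachable u v) (hu : IsGate X C u c) : IsGate X C v c := by
  obtain ⟨p⟩ := h
  induction p with
  | nil => exact hu
  | cons huv p ih =>
    rename_i u v w
    refine ih ?_
    rw [SimpleGraph.deleteEdges_adj] at huv
    obtain ⟨c', hc'⟩ := exists_isGate hX hC ⟨x, hx⟩ v
    by_cases hne : c = c'
    · exact hne ▸ hc'
    · exact absurd (hJ.mem_of_eqvGen (hJ.mem_of_mem_clique hC.1 hxy hx hy hu.1 hc'.1 hne)
        (hu.eqvGen_of_adj hX hC hne hc' huv.1 rfl)) huv.2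

theorem IsHyperplane.dist_of_reachable (hX : IsQuasiMedian X) (hJ : IsHyperplane X J) {x y u : V}
    (hxy : s(x, y) ∈ J) (h : (X.deleteEdges J).Reachable u x) :
    X.dist u y = X.dist u x + 1 := by
  obtain ⟨C, hC, hx, hy⟩ := exists_maximal_clique hX (hJ.adj hxy)
  exact ((isGate_self hC.1 hx).of_reachable hX hJ hC hxy hx hy h.symm).2 y hy (hJ.adj hxy).ne'

theorem IsHyperplane.not_reachable (hX : IsQuasiMedian X) (hJ : IsHyperplane X J) {x y : V}
    (hxy : s(x, y) ∈ J) : ¬ (X.deleteEdges J).Reachable x y := by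
  intro h
  have := hJ.dist_of_reachable hX hxy h.symm
  rw [SimpleGraph.dist_self] at this
  omega

theorem IsHyperplane.eq_of_reachable (hX : IsQuasiMedian X) (hJ : IsHyperplane X J) {x y z : V}
    (hxy : s(x, y) ∈ J) (hxz : s(x, z) ∈ J) (h : (X.deleteEdges J).Reachable y z) : y = z := by
  obtain ⟨C, hC, hx, hy⟩ := exists_maximal_clique hX (hJ.adj hxy)
  have hz := (isGate_self hC.1 hy).of_reachable hX hJ hC hxy hx hy h
  have := (isGate_self hC.1 hx).dist_eq_of_adj hX hz (hJ.adj hxy).ne (hJ.adj hxz)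
  rw [SimpleGraph.dist_self] at this
  exact ((hX.connected.preconnected z y).dist_eq_zero_iff.1 this.symm).symm

/-- Since `K4Minus` is excluded, `c` and `d` are both at distance two from `e`. The triangle
condition based at `e` for the edge `cd` yields `f`. -/
theorem IsSquare.prism (hX : IsQuasiMedian X) {a b c d e : V} (h : IsSquare X a b c d)
    (hae : X.Adj a e) (hbe : X.Adj b e) :
    ∃ f, IsSquare X a e f d ∧ IsSquare X b e f c ∧ X.Adj d f ∧ X.Adj c f := by
  have hne_ed : e ≠ d := by
    rintro rfl
    exact h.not_adj_bd hbe
  have hne_ec : e ≠ c := by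
    rintro rfl
    exact h.not_adj_ac hae
  have hed : ¬ X.Adj e d := fun h' =>
    h.not_adj_bd (hX.adj_of_common_edge hae h.adj_ab hbe.symm h.adj_da.symm h' h.ne_bd)
  have hec : ¬ X.Adj e c := fun h' =>
    h.not_adj_ac (hX.adj_of_common_edge hbe h.adj_ab.symm hae.symm h.adj_bc h' h.ne_ac)
  have dist2 : ∀ x y z, X.Adj x z → X.Adj z y → x ≠ y → ¬ X.Adj x y → X.dist x y = 2 := by
    intro x y z hxz hzy hne hn
    have h1 := hX.dist_le_succ x hzy
    rw [SimpleGraph.dist_eq_one_iff_adj.2 hxz] at h1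
    have h2 : X.dist x y ≠ 0 := fun h0 =>
      hne ((hX.connected.preconnected x y).dist_eq_zero_iff.1 h0)
    have h3 : X.dist x y ≠ 1 := fun h0 => hn (SimpleGraph.dist_eq_one_iff_adj.1 h0)
    omega
  have hd2 := dist2 e d a hae.symm h.adj_da.symm hne_ed hed
  have hc2 := dist2 e c b hbe.symm h.adj_bc hne_ec hec
  obtain ⟨f, hfd, hfc, hf⟩ := hX.triangle e d c h.adj_cd.symm (hd2.trans hc2.symm)
  have hef : X.Adj e f := SimpleGraph.dist_eq_one_iff_adj.1 (by omega)
  have hfa : ¬ X.Adj a f := fun h' => h.not_adj_ac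
    (hX.adj_of_common_edge hfd h'.symm h.adj_da hfc h.adj_cd.symm h.ne_ac)
  have hfb : ¬ X.Adj b f := fun h' => h.not_adj_bd
    (hX.adj_of_common_edge hfc h'.symm h.adj_bc.symm hfd h.adj_cd h.ne_bd)
  refine ⟨f, ⟨hae, hef, hfd, h.adj_da, ?_, hne_ed, hfa, hed⟩,
    ⟨hbe, hef, hfc, h.adj_bc.symm, ?_, hne_ec, hfb, hec⟩, hfd.symm, hfc.symm⟩
  · rintro rfl
    exact h.not_adj_ac hfc
  · rintro rfl
    exact h.not_adj_bd hfd

theorem IsHyperplane.notMem_of_square (hT : ¬ Transverse X J J) {a b c d : V}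
    (hs : IsSquare X a b c d) (h : s(a, b) ∈ J) : s(b, c) ∉ J :=
  fun h' => hT ⟨a, b, c, d, hs, h, h'⟩

theorem IsHyperplane.reachable_of_square (hT : ¬ Transverse X J J)
    {a b c d : V} (hs : IsSquare X a b c d) (h : s(a, b) ∈ J) :
    (X.deleteEdges J).Reachable b c ∧ (X.deleteEdges J).Reachable a d := by
  refine ⟨reachable_deleteEdges hs.adj_bc (notMem_of_square hT hs h),
    reachable_deleteEdges hs.adj_da.symm ?_⟩
  refine notMem_of_square hT hs.reflect.rotate.rotate.rotate ?_
  rwa [Sym2.eq_swap]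

/-- Meeting the sector of `u` passes from one clique of `J` to a parallel one: prisms carry any
vertex of a clique across a square, without crossing `J`. One then inducts along a path from `u` to
`x`. -/
theorem IsHyperplane.exists_mem_clique_reachable (hX : IsQuasiMedian X) (hJ : IsHyperplane X J)
    (hT : ¬ Transverse X J J) (hC : Maximal X.IsClique C) {x y : V} (hxy : s(x, y) ∈ J)
    (hx : x ∈ C) (hy : y ∈ C) (u : V) : ∃ z ∈ C, (X.deleteEdges J).Reachable u z := by
  let p : V → Sym2 V → Prop := fun u e =>
    ∀ D : Set V, Maximal X.IsClique D → (∀ v ∈ e, v ∈ D) →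
      ∃ z ∈ D, (X.deleteEdges J).Reachable u z
  have hp : ∀ u e f, e ∈ J → ElemParallel X e f → p u e → p u f := by
    rintro u e f he hef hpe D hD hfD
    rcases hef with ⟨a, b, c, hab, hbc, hac, rfl, rfl⟩ | ⟨a, b, c, d, h, rfl, rfl⟩
    · have hb : b ∈ D := hfD b (by simp)
      have hc : c ∈ D := hfD c (by simp)
      have ha : a ∈ D := mem_of_adj_adj hX hD hb hc hbc.ne hab hac
      refine hpe D hD ?_
      simp [ha, hb]
    · have hd : d ∈ D := hfD d (by simp)
      have hc : c ∈ D := hfD c (by simp)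
      obtain ⟨E, hE, haE, hbE⟩ := exists_maximal_clique hX h.adj_ab
      obtain ⟨z, hz, huz⟩ := hpe E hE (by simp [haE, hbE])
      have hr := reachable_of_square hT h he
      by_cases hza : a = z
      · subst hza
        exact ⟨d, hd, huz.trans hr.2⟩
      by_cases hzb : b = z
      · subst hzb
        exact ⟨c, hc, huz.trans hr.1⟩
      obtain ⟨f, hf1, hf2, hdf, hcf⟩ := h.prism hX (hE.1 haE hz hza) (hE.1 hbE hz hzb)
      refine ⟨f, mem_of_adj_adj hX hD hd hc h.adj_cd.ne' hdf.symm hcf.symm, huz.trans ?_⟩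
      exact (reachable_of_square hT hf1 (hJ.mem_of_mem_clique hE.1 he haE hbE haE hz hza)).1
  suffices H : ∀ u, p u s(x, y) from H u C hC (by simp [hx, hy])
  intro u
  obtain ⟨q⟩ := hX.connected.preconnected u x
  induction q with
  | nil => exact fun D hD h => ⟨_, h _ (by simp), SimpleGraph.Reachable.refl _⟩
  | cons huv q ih =>
    rename_i u v w
    by_cases huvJ : s(u, v) ∈ J
    -- Here `u` itself lies in the clique of the edge `uv` of `J`, and the property is transported
    -- from `uv` to `xy`.
    · exact hJ.induction huvJ (p := p u)
        (fun D hD h => ⟨_, h u (by simp), SimpleGraph.Reachable.refl _⟩)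
        (fun e f he hef => hp u e f he hef) hxy
    · intro D hD h
      obtain ⟨z, hz, hvz⟩ := ih hxy hx D hD h
      exact ⟨z, hz, (reachable_deleteEdges huv huvJ).trans hvz⟩

/-- Two vertices are equal or joined by an edge of `J`. -/
def EqOrMem (J : Set (Sym2 V)) (x y : V) : Prop := y = x ∨ s(x, y) ∈ J

theorem EqOrMem.mem_carrier {x y : V} (h : EqOrMem J x y) (hx : x ∈ carrier J) :
    y ∈ carrier J := by
  rcases h with rfl | h
  · exact hx
  · exact ⟨_, h, by simp⟩

theorem exists_mem_of_mem_carrier {x : V} (h : x ∈ carrier J) : ∃ y, s(x, y) ∈ J := by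
  obtain ⟨e, he, hx⟩ := h
  obtain ⟨y, rfl⟩ := Sym2.mem_iff_exists.1 hx
  exact ⟨y, he⟩

theorem mem_carrier_left {x y : V} (h : s(x, y) ∈ J) : x ∈ carrier J := ⟨_, h, by simp⟩

theorem IsHyperplane.exists_eqOrMem (hX : IsQuasiMedian X) (hJ : IsHyperplane X J)
    (hT : ¬ Transverse X J J) {x : V} (hx : x ∈ carrier J) (u : V) :
    ∃ z, EqOrMem J x z ∧ (X.deleteEdges J).Reachable u z := by
  obtain ⟨y, hxy⟩ := exists_mem_of_mem_carrier hx
  obtain ⟨C, hC, hx, hy⟩ := exists_maximal_clique hX (hJ.adj hxy)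
  obtain ⟨z, hz, huz⟩ := hJ.exists_mem_clique_reachable hX hT hC hxy hx hy u
  refine ⟨z, ?_, huz⟩
  by_cases h : z = x
  · exact Or.inl h
  · exact Or.inr (hJ.mem_of_mem_clique hC.1 hxy hx hy hx hz (Ne.symm h))

/-- The clique has a vertex in the sector of `z`, and two `J`-neighbours of `x` in the same sector
coincide. So the `J`-edges at a vertex span a single clique. -/
theorem IsHyperplane.mem_clique (hX : IsQuasiMedian X) (hJ : IsHyperplane X J)
    (hT : ¬ Transverse X J J) (hC : Maximal X.IsClique C) {x y z : V} (hxy : s(x, y) ∈ J)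
    (hx : x ∈ C) (hy : y ∈ C) (hxz : s(x, z) ∈ J) : z ∈ C := by
  obtain ⟨w, hw, hzw⟩ := hJ.exists_mem_clique_reachable hX hT hC hxy hx hy z
  have hne : x ≠ w := by
    rintro rfl
    exact hJ.not_reachable hX hxz hzw.symm
  rwa [hJ.eq_of_reachable hX hxz (hJ.mem_of_mem_clique hC.1 hxy hx hy hx hw hne) hzw]

theorem EqOrMem.trans (hX : IsQuasiMedian X) (hJ : IsHyperplane X J)
    (hT : ¬ Transverse X J J) {x y z : V} (hxy : EqOrMem J x y) (hyz : EqOrMem J y z) :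
    EqOrMem J x z := by
  rcases hxy with rfl | hxy
  · exact hyz
  rcases hyz with rfl | hyz
  · exact Or.inr hxy
  obtain ⟨C, hC, hx, hy⟩ := exists_maximal_clique hX (hJ.adj hxy)
  have hz := hJ.mem_clique hX hT hC (by rwa [Sym2.eq_swap]) hy hx hyz
  by_cases h : z = x
  · exact Or.inl h
  · exact Or.inr (hJ.mem_of_mem_clique hC.1 hxy hx hy hx hz (Ne.symm h))

theorem EqOrMem.eq_of_reachable (hX : IsQuasiMedian X) (hJ : IsHyperplane X J)
    {x y z : V} (hxy : EqOrMem J x y) (hxz : EqOrMem J x z)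
    (h : (X.deleteEdges J).Reachable y z) : y = z := by
  rcases hxy with rfl | hxy
  · rcases hxz with rfl | hxz
    · rfl
    · exact absurd h (hJ.not_reachable hX hxz)
  · rcases hxz with rfl | hxz
    · exact absurd h.symm (hJ.not_reachable hX hxy)
    · exact hJ.eq_of_reachable hX hxy hxz h

/-! ### Transverse hyperplanes -/

/-- Side step of the descent in `exists_square_corner`: the quadrangle condition based at `y` pushes
the side `ab` one step nearer to `xy`. -/
theorem exists_side_move (hX : IsQuasiMedian X) {x y a a' b : V} {n : ℕ} (hxy : X.Adj x y)
    (hab : X.Adj a b) (haa' : X.Adj a' a) (hxa' : X.dist x a' = n)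
    (hxb : n < X.dist x b) (hya : X.dist y a = n + 2) (hyb : X.dist y b = n + 1) :
    X.dist y a' = n + 1 ∧ ∃ b', X.Adj b' b ∧ X.Adj b' a' ∧ X.dist y b' = n := by
  have h1 := hX.dist_le_succ y haa'
  have h2 := hX.dist_le_succ a' hxy
  rw [SimpleGraph.dist_comm, SimpleGraph.dist_comm (v := x)] at h2
  have hya' : X.dist y a' = n + 1 := by omega
  have hba' : b ≠ a' := by
    rintro rfl
    omega
  obtain ⟨b', hb'b, hb'a', hb'⟩ := hX.quadrangle y b a' a hba' hab haa'.symm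
    (by omega) (by omega)
  exact ⟨hya', b', hb'b, hb'a', by omega⟩

/-- Top step of the same descent: seen from `c`, the vertex `a'` is at distance three and `b'`, `d'`
at distance two, so the quadrangle condition based at `c` applies. The neighbours `c` and `b'` of
the new corner force its distance to `x`. -/
theorem exists_top_move (hX : IsQuasiMedian X) {x a a' b b' c d d' : V} {n : ℕ}
    (hab : X.Adj a b) (hbc : X.Adj b c) (hcd : X.Adj c d) (haa' : X.Adj a' a) (hb'b : X.Adj b' b)
    (hd'd : X.Adj d' d) (hb'a' : X.Adj b' a') (hd'a' : X.Adj d' a') (hne : b' ≠ d')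
    (hxa' : X.dist x a' = n) (hxc : X.dist x c = n + 3) :
    ∃ c', X.Adj c' b' ∧ X.Adj c' d' ∧ X.dist x c' = n + 2 := by
  have hca' : X.dist c a' = 3 := by
    have h1 := hX.dist_le_succ c hab.symm
    have h2 := hX.dist_le_succ c haa'.symm
    have h3 := hX.connected.dist_triangle (u := x) (v := a') (w := c)
    rw [SimpleGraph.dist_eq_one_iff_adj.2 hbc.symm] at h1
    rw [SimpleGraph.dist_comm (u := a')] at h3
    omega
  have hcb' : X.dist c b' = 2 := by
    have h1 := hX.dist_le_succ c hb'b.symm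
    have h2 := hX.dist_le_succ c hb'a'
    rw [SimpleGraph.dist_eq_one_iff_adj.2 hbc.symm] at h1
    omega
  have hcd' : X.dist c d' = 2 := by
    have h1 := hX.dist_le_succ c hd'd.symm
    have h2 := hX.dist_le_succ c hd'a'
    rw [SimpleGraph.dist_eq_one_iff_adj.2 hcd] at h1
    omega
  obtain ⟨c', hc'b', hc'd', hc'⟩ := hX.quadrangle c b' d' a' hne hb'a'.symm hd'a'.symm
    (by omega) (by omega)
  have hcc' : X.Adj c c' := SimpleGraph.dist_eq_one_iff_adj.1 (by omega)
  refine ⟨c', hc'b', hc'd', ?_⟩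
  have h1 := hX.dist_le_succ x hcc'.symm
  have h2 := hX.dist_le_succ x hc'b'.symm
  have h3 := hX.dist_le_succ x hb'a'.symm
  omega

/-- A square facing the corner `y, x, z` slides towards `x` along a geodesic from `a`. The distances
record this position. At `n = 0` one has `b = y` and `d = z`, and `c` is the required vertex. -/
theorem exists_square_corner (hX : IsQuasiMedian X) {x y z : V} (hxy : X.Adj x y) (hxz : X.Adj x z)
    (n : ℕ) (a b c d : V) (hab : X.Adj a b) (hbc : X.Adj b c) (hcd : X.Adj c d) (had : X.Adj a d)
    (hax : X.dist x a = n) (hay : X.dist y a = n + 1) (haz : X.dist z a = n + 1)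
    (hby : X.dist y b = n) (hbz : X.dist z b = n + 2) (hdz : X.dist z d = n)
    (hcx : X.dist x c = n + 2) :
    ∃ w, X.Adj y w ∧ X.Adj w z ∧ X.dist x w = 2 := by
  induction n generalizing a b c d with
  | zero =>
    rw [(hX.connected.preconnected y b).dist_eq_zero_iff.1 hby,
      (hX.connected.preconnected z d).dist_eq_zero_iff.1 hdz]
    exact ⟨c, hbc, hcd, hcx⟩
  | succ n ih =>
    obtain ⟨a', haa', ha'x⟩ := exists_adj_dist_eq hX hax
    have hxb := hX.dist_le_succ x hbc
    have hxd := hX.dist_le_succ x hcd.symm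
    obtain ⟨hya', b', hb'b, hb'a', hyb'⟩ :=
      exists_side_move hX hxy hab haa' ha'x (by omega) hay hby
    obtain ⟨hza', d', hd'd, hd'a', hzd'⟩ :=
      exists_side_move hX hxz had haa' ha'x (by omega) haz hdz
    have hzb' : X.dist z b' = n + 2 := by
      have h1 := hX.dist_le_succ z hb'b
      have h2 := hX.dist_le_succ z hb'a'.symm
      omega
    have hne : b' ≠ d' := by
      rintro rfl
      omega
    obtain ⟨c', hc'b', hc'd', hxc'⟩ :=
      exists_top_move hX hab hbc hcd haa' hb'b hd'd hb'a' hd'a' hne ha'x hcx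
    exact ih a' b' c' d' hb'a'.symm hc'b'.symm hc'd' hd'a'.symm ha'x hya' hza' hyb' hzb' hzd' hxc'

/-- A prism allows `b` to be replaced by any other vertex of the `J`-clique of `ab` except `a`, and
this clique meets the sector of `y`. -/
theorem IsHyperplane.exists_square_reachable (hX : IsQuasiMedian X) (hJ : IsHyperplane X J)
    (hT : ¬ Transverse X J J) {a b c d y : V} (hs : IsSquare X a b c d) (h : s(a, b) ∈ J)
    (hay : ¬ (X.deleteEdges J).Reachable y a) :
    ∃ e f, IsSquare X a e f d ∧ s(a, e) ∈ J ∧ (X.deleteEdges J).Reachable y e := by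
  obtain ⟨e, rfl | he, hye⟩ := hJ.exists_eqOrMem hX hT (mem_carrier_left h) y
  · exact absurd hye hay
  by_cases hbe : b = e
  · subst hbe
    exact ⟨b, c, hs, h, hye⟩
  · have hbe' : s(b, e) ∈ J := by
      rcases EqOrMem.trans (x := b) (y := a) (z := e) hX hJ hT
        (Or.inr (by rwa [Sym2.eq_swap])) (Or.inr he) with h' | h'
      · exact absurd h'.symm hbe
      · exact h'
    obtain ⟨f, hf, -⟩ := hs.prism hX (hJ.adj he) (hJ.adj hbe')
    exact ⟨e, f, hf, he, hye⟩

theorem IsHyperplane.exists_square_reachable_left (hX : IsQuasiMedian X) (hJ₁ : IsHyperplane X J₁)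
    (hJ₂ : IsHyperplane X J₂) (hT : ¬ Transverse X J₁ J₁) (hne : J₁ ≠ J₂) {a b c d : V}
    (hs : IsSquare X a b c d) (h₁ : s(a, b) ∈ J₁) (h₂ : s(a, d) ∈ J₂) (x : V) :
    ∃ a' b' c' d', IsSquare X a' b' c' d' ∧ s(a', b') ∈ J₁ ∧ s(a', d') ∈ J₂ ∧
      (X.deleteEdges J₁).Reachable x a' ∧ (X.deleteEdges J₂).Reachable a a' := by
  by_cases hax : (X.deleteEdges J₁).Reachable x a
  · exact ⟨a, b, c, d, hs, h₁, h₂, hax, SimpleGraph.Reachable.refl _⟩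
  · obtain ⟨e, f, hs', he, hxe⟩ := hJ₁.exists_square_reachable hX hT hs h₁ hax
    refine ⟨e, a, d, f, hs'.reflect.rotate.rotate.rotate, ?_, ?_,
      hxe, ?_⟩
    · rwa [Sym2.eq_swap]
    · exact hJ₂.mem_of_square h₂ hs'.reflect
    · exact reachable_deleteEdges (hJ₁.adj he) fun h' => hne (hJ₁.eq_of_mem hJ₂ he h')

/-- Some square crosses `J₁` and `J₂`. Using prisms, its corners `a`, `b`, `d` are moved into the
sectors of `x`, `y`, `z`. Sectors determine the relevant distances, and the square is then slid down
to `x`. -/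
theorem Transverse.exists_square (hX : IsQuasiMedian X) (hJ₁ : IsHyperplane X J₁)
    (hJ₂ : IsHyperplane X J₂) (hT₁ : ¬ Transverse X J₁ J₁) (hT₂ : ¬ Transverse X J₂ J₂)
    (hT : Transverse X J₁ J₂) {x y z : V} (hxy : s(x, y) ∈ J₁) (hxz : s(x, z) ∈ J₂) :
    ∃ w, IsSquare X x y w z := by
  have hne : J₁ ≠ J₂ := fun h => hT₁ (by nth_rewrite 2 [h]; exact hT)
  obtain ⟨b, a, d, c, hs, h₁, h₂⟩ := hT
  rw [Sym2.eq_swap] at h₁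
  obtain ⟨a, b, c, d, hs, h₁, h₂, hax₁, -⟩ :=
    hJ₁.exists_square_reachable_left hX hJ₂ hT₁ hne hs.reflect.rotate.rotate.rotate h₁ h₂ x
  -- Moving the corner across `J₂` does not change its `J₁`-sector, so the first adjustment survives
  -- the second.
  obtain ⟨a', d, c, b, hs, h₂, h₁, hax₂, haa'⟩ :=
    hJ₂.exists_square_reachable_left hX hJ₁ hT₂ hne.symm hs.reflect h₂ h₁ x
  replace hax₁ := hax₁.trans haa'
  clear haa'
  rename' a' => a
  obtain ⟨b, c, hs, h₁, hby₁⟩ := hJ₁.exists_square_reachable hX hT₁ hs.reflect h₁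
    (y := y) (fun h => hJ₁.not_reachable hX hxy (hax₁.trans h.symm))
  obtain ⟨d, c, hs, h₂, hdz₂⟩ := hJ₂.exists_square_reachable hX hT₂ hs.reflect h₂
    (y := z) (fun h => hJ₂.not_reachable hX hxz (hax₂.trans h.symm))
  replace hs := hs.reflect
  have hab₂ : (X.deleteEdges J₂).Reachable a b :=
    reachable_deleteEdges hs.adj_ab fun h' => hne (hJ₁.eq_of_mem hJ₂ h₁ h')
  have had₁ : (X.deleteEdges J₁).Reachable a d :=
    reachable_deleteEdges hs.adj_da.symm fun h' => hne (hJ₁.eq_of_mem hJ₂ h' h₂)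
  have hdc : s(d, c) ∈ J₁ := hJ₁.mem_of_square h₁ hs
  have e1 := hJ₁.dist_of_reachable hX hxy hax₁.symm
  have e2 := hJ₁.dist_of_reachable hX (x := y) (y := x) (by rwa [Sym2.eq_swap]) hby₁.symm
  have e3 := hJ₁.dist_of_reachable hX h₁ hax₁
  have e4 := hJ₂.dist_of_reachable hX hxz hax₂.symm
  have e5 := hJ₂.dist_of_reachable hX (x := z) (y := x) (by rwa [Sym2.eq_swap]) hdz₂.symm
  have e6 := hJ₂.dist_of_reachable hX h₂ hax₂
  have e7 := hJ₁.dist_of_reachable hX hdc (hax₁.trans had₁)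
  have e8 := hJ₂.dist_of_reachable hX hxz (hax₂.trans hab₂).symm
  simp only [SimpleGraph.dist_comm (v := x), SimpleGraph.dist_comm (v := y),
    SimpleGraph.dist_comm (v := z)] at e1 e2 e4 e5 e8
  obtain ⟨w, hyw, hwz, hw⟩ := exists_square_corner hX (hJ₁.adj hxy) (hJ₂.adj hxz) (X.dist x a)
    a b c d hs.adj_ab hs.adj_bc hs.adj_cd hs.adj_da.symm rfl e1 e4 (by omega) (by omega) (by omega)
    (by omega)
  refine ⟨w, hJ₁.adj hxy, hyw, hwz, (hJ₂.adj hxz).symm, ?_, ?_, ?_, ?_⟩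
  · rintro rfl
    simp at hw
  · rintro rfl
    exact hne (hJ₁.eq_of_mem hJ₂ hxy hxz)
  · intro h
    rw [SimpleGraph.dist_eq_one_iff_adj.2 h] at hw
    omega
  · intro h
    refine hne (hJ₁.eq_of_mem hJ₂ (hJ₁.mem_of_triangle (a := y) (b := x) (c := z) ?_ h
      (hJ₂.adj hxz)) hxz)
    rwa [Sym2.eq_swap]

end Sectors

/-! ### Cocycles on oriented edges and their potentials -/

section Cocycles

variable {V : Type v} {X : SimpleGraph V} {A : Type w} [Group A]

/-- A labelling of the oriented edges of `X` by elements of a group, compatible with orientation,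
triangles and squares. -/
structure IsCocycle (X : SimpleGraph V) (l : V → V → A) : Prop where
  swap : ∀ x y, X.Adj x y → l y x * l x y = 1
  triangle : ∀ x y z, X.Adj x y → X.Adj y z → X.Adj x z → l y z * l x y = l x z
  square : ∀ a b c d, IsSquare X a b c d → l b c * l a b = l d c * l a d

/-- The product of the labels along a geodesic of length `n` given by a choice of parents. -/
def geodesicLabel (l : V → V → A) (par : V → V) : ℕ → V → A
  | 0, _ => 1
  | n + 1, y => l (par y) y * geodesicLabel l par n (par y)

/-- The value is the product of labels along a chosen geodesic. Triangle and quadrangle conditions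
fill the difference between two choices with triangles and squares nearer to `x₀`, so induction on
the distance shows that the choice is irrelevant. -/
theorem IsCocycle.exists_potential (hX : IsQuasiMedian X) {l : V → V → A} (hl : IsCocycle X l)
    (x₀ : V) : ∃ F : V → A, F x₀ = 1 ∧ ∀ x y, X.Adj x y → F y = l x y * F x := by
  have hpar : ∀ y, ∃ z, ∀ n, X.dist x₀ y = n + 1 → X.Adj z y ∧ X.dist x₀ z = n := by
    intro y
    by_cases h : X.dist x₀ y = 0
    · exact ⟨y, fun n hn => by omega⟩
    · obtain ⟨n, hn⟩ := Nat.exists_eq_succ_of_ne_zero h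
      obtain ⟨z, hz⟩ := exists_adj_dist_eq hX hn
      refine ⟨z, fun m hm => ?_⟩
      obtain rfl : n = m := by omega
      exact hz
  choose par hpar using hpar
  let F : V → A := fun y => geodesicLabel l par (X.dist x₀ y) y
  have hF0 : F x₀ = 1 := by
    simp only [F, SimpleGraph.dist_self]
    rfl
  have hFpar : ∀ y n, X.dist x₀ y = n + 1 → F y = l (par y) y * F (par y) := by
    intro y n hn
    simp only [F, hn, (hpar y n hn).2]
    rfl
  have step : ∀ n x y, X.Adj x y → X.dist x₀ x = n → X.dist x₀ y = n + 1 →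
      F y = l x y * F x := by
    intro n
    induction n using Nat.strong_induction_on with
    | _ n ih =>
      intro x y hxy hx hy
      rw [hFpar y n hy]
      obtain ⟨hu, hu'⟩ := hpar y n hy
      -- Both `u`, the chosen parent, and `x` are neighbours of `y` one step nearer to `x₀`. They
      -- are compared through a common neighbour `w` nearer still.
      generalize par y = u at hu hu'
      by_cases hux : u = x
      · rw [hux]
      by_cases hadj : X.Adj u x
      · obtain ⟨w, hwu, hwx, hw⟩ := hX.triangle x₀ u x hadj (by omega)
        have hFu := ih (n - 1) (by omega) w u hwu (by omega) (by omega)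
        have hFx := ih (n - 1) (by omega) w x hwx (by omega) (by omega)
        rw [hFu, hFx, ← hl.triangle w u x hwu hadj hwx, ← hl.triangle u x y hadj hxy hu]
        simp only [mul_assoc]
      · obtain ⟨w, hwu, hwx, hw⟩ := hX.quadrangle x₀ u x y hux hu.symm hxy.symm (by omega)
          (by omega)
        have hFu := ih (n - 1) (by omega) w u hwu (by omega) (by omega)
        have hFx := ih (n - 1) (by omega) w x hwx (by omega) (by omega)
        have hsq : IsSquare X w u y x := by
          refine ⟨hwu, hu, hxy.symm, hwx.symm, ?_, hux, fun h => ?_, hadj⟩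
          · rintro rfl
            omega
          · have := hX.dist_le_succ x₀ h
            omega
        rw [hFu, hFx, ← mul_assoc, hl.square w u y x hsq, mul_assoc]
  refine ⟨F, hF0, fun x y hxy => ?_⟩
  have h1 := hX.dist_le_succ x₀ hxy
  have h2 := hX.dist_le_succ x₀ hxy.symm
  rcases lt_trichotomy (X.dist x₀ x) (X.dist x₀ y) with h | h | h
  · exact step _ x y hxy rfl (by omega)
  · obtain ⟨z, hzx, hzy, hz⟩ := hX.triangle x₀ x y hxy h
    rw [step _ z y hzy rfl (by omega), step _ z x hzx rfl (by omega), ← mul_assoc,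
      hl.triangle z x y hzx hxy hzy]
  · rw [step _ y x hxy.symm rfl (by omega), ← mul_assoc, hl.swap y x hxy.symm, one_mul]

theorem potential_unique (hX : IsQuasiMedian X) {l : V → V → A} {F F' : V → A}
    (hF : ∀ x y, X.Adj x y → F y = l x y * F x) (hF' : ∀ x y, X.Adj x y → F' y = l x y * F' x)
    {x₀ : V} (h0 : F x₀ = F' x₀) (x : V) : F x = F' x := by
  obtain ⟨p⟩ := hX.connected.preconnected x₀ x
  induction p with
  | nil => exact h0
  | cons h p ih => exact ih (by rw [hF _ _ h, hF' _ _ h, h0])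

end Cocycles

/-! ### From an invariant cocycle to a virtual retract -/

section VirtualRetract

variable {G : Type u} [Group G] {V : Type v} [MulAction G V] {X : SimpleGraph V}
  {A : Type w} [Group A]

/-- The subgroup of `A` of the elements that move `x₀` inside its `G`-orbit. -/
def orbitStabilizer (α : A →* Equiv.Perm V) (hα : ∀ a (g : G) x, α a (g • x) = g • α a x) (x₀ : V) :
    Subgroup A where
  carrier := {a | ∃ g : G, α a x₀ = g • x₀}
  one_mem' := ⟨1, by simp⟩
  mul_mem' := by
    rintro a b ⟨g, hg⟩ ⟨h, hh⟩
    exact ⟨h * g, by rw [map_mul, Equiv.Perm.mul_apply, hh, hα, hg, mul_smul]⟩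
  inv_mem' := by
    rintro a ⟨g, hg⟩
    refine ⟨g⁻¹, ?_⟩
    rw [map_inv, Equiv.Perm.inv_def, Equiv.symm_apply_eq, hα, hg, inv_smul_smul]

/-- The potential provides, for each vertex, an element of `A` carrying `x₀` to it. Restricted to `G
• x₀` it embeds `G`, and an element of `A` that keeps `x₀` in its orbit can be read back as an
element of `G`. -/
theorem exists_virtualRetract_of_cocycle [ActsOnGraph G X] (hX : IsQuasiMedian X)
    (hfree : ∀ (g : G) (x : V), g • x = x → g = 1)
    (hfin : Finite (MulAction.orbitRel.Quotient G V))
    (α : A →* Equiv.Perm V) (hα : ∀ a (g : G) x, α a (g • x) = g • α a x)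
    {l : V → V → A} (hl : IsCocycle X l) (hlα : ∀ x y, X.Adj x y → α (l x y) x = y)
    (hlG : ∀ (g : G) x y, X.Adj x y → l (g • x) (g • y) = l x y) :
    ∃ φ : G →* A, Function.Injective φ ∧ IsVirtualRetract φ.range := by
  obtain ⟨x₀⟩ := hX.connected.nonempty
  obtain ⟨F, hF0, hF⟩ := hl.exists_potential hX x₀
  have hFα : ∀ x, α (F x) x₀ = x := by
    intro x
    suffices H : ∀ y, X.Walk x y → y = x₀ → α (F x) x₀ = x by
      obtain ⟨p⟩ := hX.connected.preconnected x x₀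
      exact H _ p rfl
    intro y p hy
    induction p with
    | nil => rw [hy, hF0, map_one, Equiv.Perm.one_apply]
    | cons h p ih =>
      rw [hF _ _ h.symm, map_mul, Equiv.Perm.mul_apply, ih hy, hlα _ _ h.symm]
  have hFG : ∀ (g : G) x, F (g • x) = F x * F (g • x₀) := by
    intro g x
    refine potential_unique hX (l := l) (F := fun x => F (g • x))
      (F' := fun x => F x * F (g • x₀)) ?_ ?_ (x₀ := x₀) ?_ x
    · intro x y hxy
      simp only [hF _ _ (ActsOnGraph.adj_smul g x y hxy), hlG g x y hxy]
    · intro x y hxy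
      simp only [hF _ _ hxy, mul_assoc]
    · simp only [hF0, one_mul]
  let φ : G →* A :=
    -- By `hFG`, `g ↦ F (g • x₀)` reverses products; the inverse corrects this.
    { toFun := fun g => F (g⁻¹ • x₀)
      map_one' := by rw [inv_one, one_smul, hF0]
      map_mul' := fun g h => by rw [mul_inv_rev, mul_smul, hFG h⁻¹] }
  have hφ : ∀ g, α (φ g) x₀ = g⁻¹ • x₀ := fun g => hFα _
  let H := orbitStabilizer (G := G) α hα x₀
  have hfree' : ∀ g h : G, g • x₀ = h • x₀ → g = h := by
    intro g h hgh
    rw [← inv_smul_eq_iff, smul_smul] at hgh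
    exact (inv_mul_eq_one.1 (hfree _ _ hgh)).symm
  choose s hs using fun a : H => a.2
  let r : H →* G :=
    -- Since `α` commutes with `G`, `s` also reverses products.
    { toFun := fun a => (s a)⁻¹
      map_one' := by
        rw [inv_eq_one]
        refine hfree' _ _ ?_
        rw [← hs, one_smul, Subgroup.coe_one, map_one, Equiv.Perm.one_apply]
      map_mul' := fun a b => by
        rw [← mul_inv_rev, inv_inj]
        refine hfree' _ _ ?_
        rw [← hs, Subgroup.coe_mul, map_mul, Equiv.Perm.mul_apply, hs b, hα, hs a, mul_smul] }
  have hrφ : ∀ (g : G) (hg : φ g ∈ H), r ⟨φ g, hg⟩ = g := by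
    intro g hg
    change (s ⟨φ g, hg⟩)⁻¹ = g
    rw [inv_eq_iff_eq_inv]
    exact hfree' _ _ (by rw [← hs, hφ])
  have hφH : ∀ g, φ g ∈ H := fun g => ⟨g⁻¹, hφ g⟩
  refine ⟨φ, fun g h hgh => ?_, H, ?_, ?_, φ.rangeRestrict.comp r, ?_⟩
  · rw [← hrφ g (hφH g), ← hrφ h (hφH h)]
    congr 1
    exact Subtype.ext hgh
  · have : Finite (A ⧸ H) := by
      -- The coset of `a` is determined by the `G`-orbit of `α a x₀`.
      let q : A ⧸ H → MulAction.orbitRel.Quotient G V :=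
        Quotient.lift (fun a => Quotient.mk (MulAction.orbitRel G V) (α a x₀)) (by
          intro a b hab
          obtain ⟨g, hg⟩ := QuotientGroup.leftRel_apply.1 hab
          refine Quotient.sound (MulAction.orbitRel_apply.2 ⟨g⁻¹, ?_⟩)
          rw [map_mul, Equiv.Perm.mul_apply, map_inv, Equiv.Perm.inv_def,
            Equiv.symm_apply_eq, hα] at hg
          simp only [hg, inv_smul_smul])
      refine Finite.of_injective q ?_
      rintro ⟨a⟩ ⟨b⟩ hab
      obtain ⟨g, hg⟩ := MulAction.orbitRel_apply.1 (Quotient.exact hab)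
      refine QuotientGroup.eq.2 ⟨g⁻¹, ?_⟩
      rw [map_mul, Equiv.Perm.mul_apply, map_inv, Equiv.Perm.inv_def, Equiv.symm_apply_eq, hα]
      simp only at hg
      rw [← hg, inv_smul_smul]
    exact Subgroup.finiteIndex_of_finite_quotient
  · rintro _ ⟨g, rfl⟩
    exact hφH g
  · rintro ⟨_, g, rfl⟩
    exact Subtype.ext (congrArg φ (hrφ g (hφH g)))

end VirtualRetract

/-! ### Special actions: freeness and colourings of the sectors of one hyperplane -/

section SpecialActions

variable {G : Type u} [Group G] {V : Type v} [MulAction G V] {X : SimpleGraph V}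
  {J J₁ J₂ : Set (Sym2 V)}

theorem mk_smul_mem_smul_iff (g : G) {x y : V} : s(g • x, g • y) ∈ g • J ↔ s(x, y) ∈ J := by
  rw [← smul_mk, Set.smul_mem_smul_set_iff]

theorem smul_mem_carrier {x : V} (h : x ∈ carrier J) (g : G) : g • x ∈ carrier (g • J) := by
  obtain ⟨y, hy⟩ := exists_mem_of_mem_carrier h
  exact mem_carrier_left ((mk_smul_mem_smul_iff g).2 hy)

theorem EqOrMem.smul {x y : V} (h : EqOrMem J x y) (g : G) : EqOrMem (g • J) (g • x) (g • y) := by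
  rcases h with rfl | h
  · exact Or.inl rfl
  · exact Or.inr ((mk_smul_mem_smul_iff g).2 h)

section

variable [ActsOnGraph G X]

theorem adj_smul_iff (g : G) {x y : V} : X.Adj (g • x) (g • y) ↔ X.Adj x y := by
  refine ⟨fun h => ?_, ActsOnGraph.adj_smul g x y⟩
  have := ActsOnGraph.adj_smul g⁻¹ _ _ h
  rwa [inv_smul_smul, inv_smul_smul] at this

theorem IsSquare.smul {a b c d : V} (h : IsSquare X a b c d) (g : G) :
    IsSquare X (g • a) (g • b) (g • c) (g • d) where
  adj_ab := (adj_smul_iff g).2 h.adj_ab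
  adj_bc := (adj_smul_iff g).2 h.adj_bc
  adj_cd := (adj_smul_iff g).2 h.adj_cd
  adj_da := (adj_smul_iff g).2 h.adj_da
  ne_ac := fun h' => h.ne_ac (MulAction.injective g h')
  ne_bd := fun h' => h.ne_bd (MulAction.injective g h')
  not_adj_ac := fun h' => h.not_adj_ac ((adj_smul_iff g).1 h')
  not_adj_bd := fun h' => h.not_adj_bd ((adj_smul_iff g).1 h')

theorem ElemParallel.smul {e f : Sym2 V} (h : ElemParallel X e f) (g : G) :
    ElemParallel X (g • e) (g • f) := by
  rcases h with ⟨a, b, c, hab, hbc, hac, rfl, rfl⟩ | ⟨a, b, c, d, h, rfl, rfl⟩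
  · exact Or.inl ⟨g • a, g • b, g • c, (adj_smul_iff g).2 hab, (adj_smul_iff g).2 hbc,
      (adj_smul_iff g).2 hac, rfl, rfl⟩
  · exact Or.inr ⟨g • a, g • b, g • c, g • d, h.smul g, rfl, rfl⟩

theorem eqvGen_elemParallel_smul {e f : Sym2 V} (h : Relation.EqvGen (ElemParallel X) e f)
    (g : G) : Relation.EqvGen (ElemParallel X) (g • e) (g • f) := by
  induction h with
  | rel e f h => exact Relation.EqvGen.rel _ _ (h.smul g)
  | refl e => exact Relation.EqvGen.refl _
  | symm e f _ ih => exact Relation.EqvGen.symm _ _ ih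
  | trans e f g _ _ ih1 ih2 => exact Relation.EqvGen.trans _ _ _ ih1 ih2

theorem IsHyperplane.smul (hJ : IsHyperplane X J) (g : G) : IsHyperplane X (g • J) := by
  obtain ⟨e, he, rfl⟩ := hJ
  refine ⟨g • e, ?_, ?_⟩
  · induction e using Sym2.ind with
    | _ x y => exact (adj_smul_iff g).2 he
  · ext f
    rw [Set.mem_smul_set_iff_inv_smul_mem]
    constructor <;> intro h
    · simpa using eqvGen_elemParallel_smul h g
    · simpa using eqvGen_elemParallel_smul h g⁻¹

theorem Transverse.smul (h : Transverse X J₁ J₂) (g : G) :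
    Transverse X (g • J₁) (g • J₂) := by
  obtain ⟨a, b, c, d, hs, h1, h2⟩ := h
  exact ⟨_, _, _, _, hs.smul g, (mk_smul_mem_smul_iff g).2 h1, (mk_smul_mem_smul_iff g).2 h2⟩

theorem reachable_smul {x y : V} (h : (X.deleteEdges J).Reachable x y) (g : G) :
    (X.deleteEdges (g • J)).Reachable (g • x) (g • y) := by
  let f : X.deleteEdges J →g X.deleteEdges (g • J) :=
    ⟨fun x => g • x, fun {a b} h => by
      rw [SimpleGraph.deleteEdges_adj] at h ⊢
      exact ⟨(adj_smul_iff g).2 h.1, fun h' => h.2 ((mk_smul_mem_smul_iff g).1 h')⟩⟩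
  exact h.map f

theorem reachable_smul_iff {x y : V} (g : G) :
    (X.deleteEdges (g • J)).Reachable (g • x) (g • y) ↔ (X.deleteEdges J).Reachable x y := by
  refine ⟨fun h => ?_, fun h => reachable_smul h g⟩
  simpa using reachable_smul h g⁻¹

namespace IsSpecialAction

theorem not_transverse_self (hS : IsSpecialAction G X) (hJ : IsHyperplane X J) :
    ¬ Transverse X J J := by
  simpa using hS.not_transverse_smul J hJ 1

theorem smul_eq_of_mem_carrier (hS : IsSpecialAction G X) (hJ : IsHyperplane X J) {g : G} {x : V}
    (hx : x ∈ carrier J) (hgx : x ∈ carrier (g • J)) : g • J = J := by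
  by_contra hne
  exact hS.not_tangent_smul J hJ g ⟨Ne.symm hne, hS.not_transverse_smul J hJ g, x, hx, hgx⟩

theorem reachable_smul_self (hS : IsSpecialAction G X) (hJ : IsHyperplane X J) {g : G}
    (hg : g • J = J) {u : V} (hu : (X.deleteEdges J).Reachable (g • u) u) (x : V) :
    (X.deleteEdges J).Reachable (g • x) x := by
  have h1 := hS.free_sectors J hJ
    (MulAction.toPermHom _ _ (⟨g, hg⟩ : MulAction.stabilizer G J)) ⟨_, rfl⟩
    ((X.deleteEdges J).connectedComponentMk u) (SimpleGraph.ConnectedComponent.eq.2 hu)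
  exact SimpleGraph.ConnectedComponent.eq.1
    (congrArg (fun σ : Equiv.Perm _ => σ ((X.deleteEdges J).connectedComponentMk x)) h1)

end IsSpecialAction

theorem exists_isHyperplane_mem {x y : V} (h : X.Adj x y) : ∃ J, IsHyperplane X J ∧ s(x, y) ∈ J :=
  ⟨_, ⟨s(x, y), h, rfl⟩, Relation.EqvGen.refl _⟩

/-- If `g` fixes `x`, it stabilises each hyperplane `J` with an edge `xy`, since `J` and `g • J`
share `x`. It fixes the sector of `x`, hence all sectors, so `g • y` and `y` are `J`-neighbours of
`x` in one sector and agree. Thus fixed points propagate along edges, and faithfulness concludes. -/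
theorem IsSpecialAction.free (hX : IsQuasiMedian X) (hS : IsSpecialAction G X) {g : G} {x : V}
    (hg : g • x = x) : g = 1 := by
  have step : ∀ x y, X.Adj x y → g • x = x → g • y = y := by
    intro x y hxy hg
    obtain ⟨J, hJ, hxyJ⟩ := exists_isHyperplane_mem hxy
    have hgJ : g • J = J := by
      refine hS.smul_eq_of_mem_carrier hJ (mem_carrier_left hxyJ) ?_
      have := smul_mem_carrier (mem_carrier_left hxyJ) g
      rwa [hg] at this
    have h1 := hS.reachable_smul_self hJ hgJ (u := x)
      (by rw [hg]) y
    have h2 := (mk_smul_mem_smul_iff (J := J) g).2 hxyJ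
    rw [hg, hgJ] at h2
    exact hJ.eq_of_reachable hX h2 hxyJ h1
  have := hS.faithful
  refine FaithfulSMul.eq_of_smul_eq_smul (α := V) fun y => ?_
  rw [one_smul]
  obtain ⟨p⟩ := hX.connected.preconnected x y
  induction p with
  | nil => exact hg
  | cons h p ih => exact ih (step _ _ h hg)

end

/-- A free `K`-set is `K` times its set of orbits. The finite set of orbits is identified with a
cyclic group only to make the product a group. -/
theorem exists_equivariant_bijective {K : Type u} {Ω : Type v} [Group K] [MulAction K Ω]
    [Nonempty Ω] (hfree : ∀ (k : K) (ω : Ω), k • ω = ω → k = 1)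
    [Finite (MulAction.orbitRel.Quotient K Ω)] :
    ∃ (n : ℕ) (c : Ω → K × Multiplicative (ZMod n)), Function.Bijective c ∧
      ∀ k ω, c (k • ω) = (k, 1) * c ω := by
  let Q := MulAction.orbitRel.Quotient K Ω
  let q : Ω → Q := Quotient.mk (MulAction.orbitRel K Ω)
  have : Nonempty Q := ‹Nonempty Ω›.map q
  have hn : NeZero (Nat.card Q) := ⟨Nat.card_pos.ne'⟩
  let t : Q ≃ ZMod (Nat.card Q) :=
    (Finite.equivFin Q).trans (Finite.equivFinOfCardEq (Nat.card_zmod _)).symm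
  have hrep : ∀ ω, ∃ k : K, k • (q ω).out = ω := by
    intro ω
    obtain ⟨k, hk⟩ := MulAction.orbitRel_apply.1 (Quotient.exact (Quotient.out_eq (q ω)))
    exact ⟨k⁻¹, by rw [← hk, inv_smul_smul]⟩
  choose k hk using hrep
  have hq : ∀ (a : K) (ω : Ω), q (a • ω) = q ω := fun a ω =>
    Quotient.sound (MulAction.orbitRel_apply.2 ⟨a, rfl⟩)
  have hinj : ∀ (a b : K) (ω : Ω), a • ω = b • ω → a = b := by
    intro a b ω h
    rw [← inv_smul_eq_iff, smul_smul] at h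
    exact (inv_mul_eq_one.1 (hfree _ _ h)).symm
  refine ⟨Nat.card Q, fun ω => (k ω, Multiplicative.ofAdd (t (q ω))), ⟨?_, ?_⟩, ?_⟩
  · intro ω ω' h
    obtain ⟨h1, h2⟩ := Prod.ext_iff.1 h
    have h3 : q ω = q ω' := t.injective (Multiplicative.ofAdd.injective h2)
    simp only at h1
    rw [← hk ω, ← hk ω', h1, h3]
  · rintro ⟨a, m⟩
    refine ⟨a • (t.symm m.toAdd).out, ?_⟩
    have h1 : q (a • (t.symm m.toAdd).out) = t.symm m.toAdd := by
      rw [hq]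
      exact Quotient.out_eq _
    refine Prod.ext ?_ ?_
    · refine hinj _ _ (t.symm m.toAdd).out ?_
      have := hk (a • (t.symm m.toAdd).out)
      rwa [h1] at this
    · simp only [h1, Equiv.apply_symm_apply]
      exact ofAdd_toAdd m
  · intro a ω
    refine Prod.ext ?_ ?_
    · refine hinj _ _ (q ω).out ?_
      simp only [Prod.fst_mul]
      rw [mul_smul, hk]
      nth_rewrite 1 [← hq a ω]
      exact hk _
    · simp [hq]

variable [ActsOnGraph G X]

/-- The quotient of `stab(J)` by the kernel of its action on sectors acts freely on them. It has
finitely many orbits: each sector contains a vertex of the carrier, and an element of `G` carrying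
one vertex of the carrier to another stabilises `J`. -/
theorem IsSpecialAction.exists_coloring (hX : IsQuasiMedian X) (hS : IsSpecialAction G X)
    (hfin : Finite (MulAction.orbitRel.Quotient G V)) (hJ : IsHyperplane X J) :
    ∃ (B : Type u) (_ : Group B) (c : V → B) (τ : MulAction.stabilizer G J →* B),
      Function.Surjective c ∧ (∀ x y, c x = c y ↔ (X.deleteEdges J).Reachable x y) ∧
      ∀ (g : MulAction.stabilizer G J) x, c ((g : G) • x) = τ g * c x := by
  let f := MulAction.toPermHom (MulAction.stabilizer G J) (Sector X J)
  let K := MulAction.stabilizer G J ⧸ f.ker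
  let _ : MulAction K (Sector X J) := MulAction.compHom _ (QuotientGroup.kerLift f)
  obtain ⟨x₀, hx₀⟩ : (carrier J).Nonempty := by
    obtain ⟨e, he, rfl⟩ := id hJ
    induction e using Sym2.ind with
    | _ x y => exact ⟨x, s(x, y), Relation.EqvGen.refl _, by simp⟩
  have : Nonempty (Sector X J) := ⟨(X.deleteEdges J).connectedComponentMk x₀⟩
  have hfree : ∀ (k : K) (S : Sector X J), k • S = S → k = 1 := by
    intro k S h
    refine QuotientGroup.kerLift_injective f ?_
    rw [map_one]
    refine hS.free_sectors J hJ _ ?_ S h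
    induction k using QuotientGroup.induction_on with
    | _ g => exact ⟨g, rfl⟩
  have hT := hS.not_transverse_self hJ
  have hrep : ∀ S : Sector X J, ∃ z, z ∈ carrier J ∧
      (X.deleteEdges J).connectedComponentMk z = S := by
    intro S
    induction S using SimpleGraph.ConnectedComponent.ind with
    | h u =>
      obtain ⟨z, hz, huz⟩ := hJ.exists_eqOrMem hX hT hx₀ u
      exact ⟨z, hz.mem_carrier hx₀, SimpleGraph.ConnectedComponent.eq.2 huz.symm⟩
  choose z hz hzS using hrep
  have : Finite (MulAction.orbitRel.Quotient K (Sector X J)) := by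
    refine Finite.of_injective (β := MulAction.orbitRel.Quotient G V)
      (fun q => Quotient.mk (MulAction.orbitRel G V) (z q.out)) fun q q' h => ?_
    obtain ⟨g, hg⟩ := MulAction.orbitRel_apply.1 (Quotient.exact h)
    simp only at hg
    have hgJ : g • J = J := by
      refine hS.smul_eq_of_mem_carrier hJ (hz q.out) ?_
      rw [← hg]
      exact smul_mem_carrier (hz _) g
    rw [← Quotient.out_eq q, ← Quotient.out_eq q']
    refine Quotient.sound (MulAction.orbitRel_apply.2 ⟨QuotientGroup.mk ⟨g, hgJ⟩, ?_⟩)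
    rw [← hzS q.out, ← hg]
    nth_rewrite 1 [← hzS q'.out]
    rfl
  obtain ⟨n, c, hc, hck⟩ := exists_equivariant_bijective hfree
  refine ⟨K × Multiplicative (ZMod n), inferInstance,
    fun x => c ((X.deleteEdges J).connectedComponentMk x),
    (MonoidHom.inl K _).comp (QuotientGroup.mk' f.ker), ?_, ?_, ?_⟩
  · intro b
    obtain ⟨S, rfl⟩ := hc.2 b
    exact ⟨z S, congrArg c (hzS S)⟩
  · intro x y
    rw [hc.1.eq_iff, SimpleGraph.ConnectedComponent.eq]
  · intro g x
    exact hck (QuotientGroup.mk g) ((X.deleteEdges J).connectedComponentMk x)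

/-- The vertices of a clique `C` of `J` correspond to the sectors, hence to the elements of `B`. So
`stab(C)` embeds through `τ`, because `G` acts freely on vertices, and its cosets inject into the
vertex orbits. -/
theorem IsSpecialAction.isFiniteExtension (hX : IsQuasiMedian X) (hS : IsSpecialAction G X)
    (hfin : Finite (MulAction.orbitRel.Quotient G V)) (hJ : IsHyperplane X J)
    {B : Type u} [Group B] {c : V → B} {τ : MulAction.stabilizer G J →* B}
    (hsurj : Function.Surjective c) (hc : ∀ x y, c x = c y ↔ (X.deleteEdges J).Reachable x y)
    (hτ : ∀ (g : MulAction.stabilizer G J) x, c ((g : G) • x) = τ g * c x) :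
    ∃ C : Set V, Maximal X.IsClique C ∧ IsFiniteExtension B (MulAction.stabilizer G C) := by
  obtain ⟨x, y, hxy⟩ : ∃ x y, s(x, y) ∈ J := by
    obtain ⟨e, he, rfl⟩ := id hJ
    induction e using Sym2.ind with
    | _ x y => exact ⟨x, y, Relation.EqvGen.refl _⟩
  obtain ⟨C, hC, hx, hy⟩ := exists_maximal_clique hX (hJ.adj hxy)
  have hmem : ∀ {a b}, a ∈ C → b ∈ C → EqOrMem J a b := by
    intro a b ha hb
    by_cases h : b = a
    · exact Or.inl h
    · exact Or.inr (hJ.mem_of_mem_clique hC.1 hxy hx hy ha hb (Ne.symm h))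
  have hsmul : ∀ {g : G} {a}, g ∈ MulAction.stabilizer G C → a ∈ C → g • a ∈ C := by
    intro g a hg ha
    have := Set.smul_mem_smul_set (a := g) ha
    rwa [MulAction.mem_stabilizer_iff.1 hg] at this
  have hT := hS.not_transverse_self hJ
  have hle : MulAction.stabilizer G C ≤ MulAction.stabilizer G J := by
    intro g hg
    exact hS.smul_eq_of_mem_carrier hJ
      ((hmem hx (hsmul hg hx)).mem_carrier (mem_carrier_left hxy))
      (smul_mem_carrier (mem_carrier_left hxy) g)
  have hex : ∀ b : B, ∃ a ∈ C, c a = b := by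
    intro b
    obtain ⟨u, rfl⟩ := hsurj b
    obtain ⟨a, ha, hua⟩ := hJ.exists_mem_clique_reachable hX hT hC hxy hx hy u
    exact ⟨a, ha, ((hc _ _).2 hua).symm⟩
  choose v hv hcv using hex
  let f := τ.comp (Subgroup.inclusion hle)
  refine ⟨C, hC, f, ?_, ?_⟩
  · refine (injective_iff_map_eq_one _).2 fun g hg => ?_
    have h1 := hτ (Subgroup.inclusion hle g) x
    change τ (Subgroup.inclusion hle g) = 1 at hg
    rw [hg, one_mul, hc] at h1
    refine Subtype.ext (hS.free hX (x := x) ?_)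
    exact EqOrMem.eq_of_reachable hX hJ (hmem hx (hsmul g.2 hx)) (hmem hx hx) h1
  · have : Finite (B ⧸ f.range) := by
      refine Finite.of_injective (β := MulAction.orbitRel.Quotient G V)
        -- `τ` translates colours on the left whereas the cosets are left cosets, hence the inverse.
        (fun q => Quotient.mk (MulAction.orbitRel G V) (v q.out⁻¹)) fun q q' h => ?_
      obtain ⟨g, hg⟩ := MulAction.orbitRel_apply.1 (Quotient.exact h)
      simp only at hg
      have hgJ : g • J = J := by
        refine hS.smul_eq_of_mem_carrier hJ (x := g • v q'.out⁻¹) ?_ ?_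
        · rw [hg]
          exact (hmem hx (hv _)).mem_carrier (mem_carrier_left hxy)
        · exact smul_mem_carrier ((hmem hx (hv _)).mem_carrier (mem_carrier_left hxy)) g
      have hgC : g • C = C := by
        -- An element stabilising `J` and sending one vertex of `C` into `C` preserves `C`, since
        -- the `J`-neighbours of a vertex of `C` are in `C`. It is applied to `g` and `g⁻¹`.
        have key : ∀ (h : G) (a b : V), h • J = J → a ∈ C → b ∈ C → h • a = b →
            ∀ d ∈ C, h • d ∈ C := by
          intro h a b hJh ha hb hab d hd
          have h1 := (hmem ha hd).smul h
          rw [hJh, hab] at h1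
          rcases h1 with h1 | h1
          · rwa [h1]
          · by_cases hbx : b = x
            · subst hbx
              exact hJ.mem_clique hX hT hC hxy hx hy h1
            · have hbx' := (hmem hb hx).resolve_left (Ne.symm hbx)
              exact hJ.mem_clique hX hT hC hbx' hb hx h1
        refine Set.Subset.antisymm ?_ fun d hd => ?_
        · rintro _ ⟨d, hd, rfl⟩
          exact key g _ _ hgJ (hv _) (hv _) hg d hd
        · rw [Set.mem_smul_set_iff_inv_smul_mem]
          exact key g⁻¹ _ _ (by rw [inv_smul_eq_iff, hgJ]) (hv q.out⁻¹) (hv q'.out⁻¹)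
            (by rw [← hg, inv_smul_smul]) d hd
      have h1 := hτ ⟨g, hgJ⟩ (v q'.out⁻¹)
      simp only [hg, hcv] at h1
      rw [← QuotientGroup.out_eq' q, ← QuotientGroup.out_eq' q']
      refine QuotientGroup.eq.2 ⟨⟨g, hgC⟩, ?_⟩
      change τ ⟨g, hgJ⟩ = _
      rw [h1, inv_mul_cancel_right]
    exact Subgroup.finiteIndex_of_finite_quotient

end SpecialActions

/-! ### Orbits of hyperplanes and the graph of the graph product -/

section HyperplaneClasses

variable (G : Type u) [Group G] {V : Type v} [MulAction G V] (X : SimpleGraph V)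

/-- The orbits of hyperplanes. -/
def HyperplaneClass : Type v :=
  {o : MulAction.orbitRel.Quotient G (Set (Sym2 V)) //
    ∃ J, IsHyperplane X J ∧ Quotient.mk (MulAction.orbitRel G (Set (Sym2 V))) J = o}

variable {G X}

/-- `J` is a hyperplane in the class `i`. -/
def HyperplaneClass.Mem (i : HyperplaneClass G X) (J : Set (Sym2 V)) : Prop :=
  IsHyperplane X J ∧ Quotient.mk (MulAction.orbitRel G (Set (Sym2 V))) J = i.1

namespace HyperplaneClass

variable {i j : HyperplaneClass G X} {J J₁ J₂ : Set (Sym2 V)}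

variable (G) in
theorem exists_mem_of_isHyperplane (hJ : IsHyperplane X J) :
    ∃ i : HyperplaneClass G X, i.Mem J :=
  ⟨⟨_, J, hJ, rfl⟩, hJ, rfl⟩

theorem exists_mem (i : HyperplaneClass G X) : ∃ J, i.Mem J := i.2

theorem Mem.eq (hi : i.Mem J) (hj : j.Mem J) : i = j := Subtype.ext (hi.2.symm.trans hj.2)

theorem Mem.exists_smul_eq (h₁ : i.Mem J₁) (h₂ : i.Mem J₂) : ∃ g : G, g • J₁ = J₂ :=
  MulAction.orbitRel_apply.1 (Quotient.exact (h₂.2.trans h₁.2.symm))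

theorem Mem.smul [ActsOnGraph G X] (h : i.Mem J) (g : G) : i.Mem (g • J) :=
  ⟨h.1.smul g, (Quotient.sound (MulAction.orbitRel_apply.2 ⟨g, rfl⟩)).trans h.2⟩

variable [ActsOnGraph G X]

/-- A hyperplane is neither transverse nor tangent to its translates. This makes the action of a
vertex-group well defined. -/
theorem Mem.eq_of_mem_carrier (hS : IsSpecialAction G X) (h₁ : i.Mem J₁) (h₂ : i.Mem J₂) {x : V}
    (hx₁ : x ∈ carrier J₁) (hx₂ : x ∈ carrier J₂) : J₁ = J₂ := by
  obtain ⟨g, rfl⟩ := h₁.exists_smul_eq h₂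
  exact (hS.smul_eq_of_mem_carrier h₁.1 hx₁ hx₂).symm

/-- Two classes of hyperplanes are adjacent if they contain transverse hyperplanes. -/
def graph (hS : IsSpecialAction G X) : SimpleGraph (HyperplaneClass G X) where
  Adj i j := ∃ J₁ J₂, i.Mem J₁ ∧ j.Mem J₂ ∧ Transverse X J₁ J₂
  symm := ⟨fun _ _ ⟨J₁, J₂, h₁, h₂, hT⟩ => ⟨J₂, J₁, h₂, h₁, hT.symm⟩⟩
  loopless := ⟨fun i ⟨J₁, J₂, h₁, h₂, hT⟩ => by
    obtain ⟨g, rfl⟩ := h₁.exists_smul_eq h₂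
    exact hS.not_transverse_smul J₁ h₁.1 g hT⟩

variable {hS : IsSpecialAction G X}

/-- A transverse pair of the two classes can be translated so that its first member is `J₁`. Then
`J₂` is a translate of the second member, so it cannot be tangent to `J₁`. -/
theorem transverse_of_adj (hij : (graph hS).Adj i j) (h₁ : i.Mem J₁) (h₂ : j.Mem J₂) {x : V}
    (hx₁ : x ∈ carrier J₁) (hx₂ : x ∈ carrier J₂) : Transverse X J₁ J₂ := by
  by_contra hT
  obtain ⟨J₁', J₂', h₁', h₂', hT'⟩ := id hij
  obtain ⟨g, rfl⟩ := h₁'.exists_smul_eq h₁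
  obtain ⟨k, rfl⟩ := (h₂'.smul g).exists_smul_eq h₂
  refine hS.not_tangent_of_transverse _ _ h₁.1 (h₂'.smul g).1 k (hT'.smul g)
    ⟨fun h => ?_, hT, x, hx₁, hx₂⟩
  rw [← h] at h₂
  exact hij.ne (h₁.eq h₂)

theorem exists_square_of_adj (hX : IsQuasiMedian X) (hij : (graph hS).Adj i j) (h₁ : i.Mem J₁)
    (h₂ : j.Mem J₂) {x y z : V} (hxy : s(x, y) ∈ J₁) (hxz : s(x, z) ∈ J₂) :
    ∃ w, IsSquare X x y w z :=
  (transverse_of_adj hij h₁ h₂ (mem_carrier_left hxy) (mem_carrier_left hxz)).exists_square hX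
    h₁.1 h₂.1 (hS.not_transverse_self h₁.1) (hS.not_transverse_self h₂.1) hxy hxz

theorem mem_carrier_of_adj (hX : IsQuasiMedian X) (hij : (graph hS).Adj i j) (h₁ : i.Mem J₁)
    (h₂ : j.Mem J₂) {x y : V} (hxy : s(x, y) ∈ J₁) (hy : y ∈ carrier J₂) : x ∈ carrier J₂ := by
  obtain ⟨t, ht⟩ := exists_mem_of_mem_carrier hy
  rw [Sym2.eq_swap] at hxy
  obtain ⟨w, hw⟩ := exists_square_of_adj hX hij h₁ h₂ hxy ht
  exact mem_carrier_left (h₂.1.mem_of_square ht hw.reflect)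

end HyperplaneClass

end HyperplaneClasses

/-! ### Colourings of sectors and the induced action -/

section ColorSystems

/-- Compatible colourings of the sectors delimited by the hyperplanes of `X` by the elements of
groups that depend only on the classes of the hyperplanes. -/
structure ColorSystem (G : Type u) [Group G] {V : Type v} [MulAction G V] (X : SimpleGraph V)
    (B : HyperplaneClass G X → Type u) [∀ i, Group (B i)] where
  color : ∀ i, Set (Sym2 V) → V → B i
  surjective : ∀ {i J}, i.Mem J → Function.Surjective (color i J)
  color_eq_iff : ∀ {i J}, i.Mem J →
    ∀ {x y}, color i J x = color i J y ↔ (X.deleteEdges J).Reachable x y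
  color_smul : ∀ {i J}, i.Mem J →
    ∀ g : G, ∃ b, ∀ x, color i (g • J) (g • x) = b * color i J x

variable {G : Type u} [Group G] {V : Type v} [MulAction G V] {X : SimpleGraph V}
  {B : HyperplaneClass G X → Type u} [∀ i, Group (B i)]

theorem IsSpecialAction.exists_colorSystem [ActsOnGraph G X] (hX : IsQuasiMedian X)
    (hS : IsSpecialAction G X) (hfin : Finite (MulAction.orbitRel.Quotient G V)) :
    ∃ (B : HyperplaneClass G X → Type u) (_ : ∀ i, Group (B i)),
      (∀ i, Nontrivial (B i)) ∧
      (∀ i, ∃ C : Set V, Maximal X.IsClique C ∧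
        IsFiniteExtension (B i) (MulAction.stabilizer G C)) ∧
      Nonempty (ColorSystem G X B) := by
  choose J hJ using fun i : HyperplaneClass G X => i.exists_mem
  choose B hB c τ hsurj hc hτ using fun i => hS.exists_coloring hX hfin (hJ i).1
  -- The translating element is chosen for every set `K`; outside the class `i` its value is
  -- irrelevant.
  have hrep : ∀ i K, ∃ g : G, HyperplaneClass.Mem i K → g • J i = K := by
    intro i K
    by_cases h : i.Mem K
    · obtain ⟨g, hg⟩ := (hJ i).exists_smul_eq h
      exact ⟨g, fun _ => hg⟩
    · exact ⟨1, fun h' => absurd h' h⟩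
  choose t ht using hrep
  refine ⟨B, hB, fun i => ?_, fun i => ?_, ⟨⟨fun i K x => c i ((t i K)⁻¹ • x), ?_, ?_, ?_⟩⟩⟩
  · obtain ⟨x, y, hxy⟩ : ∃ x y, s(x, y) ∈ J i := by
      obtain ⟨e, he, heq⟩ := id (hJ i).1
      induction e using Sym2.ind with
      | _ x y => exact ⟨x, y, heq ▸ Relation.EqvGen.refl _⟩
    exact ⟨c i x, c i y, fun h => (hJ i).1.not_reachable hX hxy ((hc i x y).1 h)⟩
  · exact hS.isFiniteExtension hX hfin (hJ i).1 (hsurj i) (hc i) (hτ i)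
  · intro i K hK b
    obtain ⟨x, rfl⟩ := hsurj i b
    exact ⟨t i K • x, by simp⟩
  · intro i K hK x y
    rw [hc, ← reachable_smul_iff (t i K), ht i K hK, smul_inv_smul, smul_inv_smul]
  · intro i K hK g
    -- Read in the representative `J i`, the element `g` becomes an element of its stabiliser, which
    -- `τ` turns into a left translation of colours.
    have hg : (t i (g • K))⁻¹ * g * t i K ∈ MulAction.stabilizer G (J i) := by
      rw [MulAction.mem_stabilizer_iff, mul_smul, mul_smul, ht i K hK, inv_smul_eq_iff,
        ht i _ (hK.smul g)]
    refine ⟨τ i ⟨_, hg⟩, fun x => ?_⟩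
    rw [← hτ i ⟨_, hg⟩]
    simp only [mul_smul, smul_inv_smul]

namespace ColorSystem

variable (S : ColorSystem G X B) {i j : HyperplaneClass G X} {J J₁ J₂ : Set (Sym2 V)}

/-- `y` is the image of `x` under `a`. -/
def Move (i : HyperplaneClass G X) (a : B i) (x y : V) : Prop :=
  (∃ J, i.Mem J ∧ x ∈ carrier J ∧ EqOrMem J x y ∧ S.color i J y = S.color i J x * a⁻¹) ∨
    ((∀ J, i.Mem J → x ∉ carrier J) ∧ y = x)

theorem move_one (i : HyperplaneClass G X) (x : V) : S.Move i 1 x x := by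
  by_cases h : ∃ J, i.Mem J ∧ x ∈ carrier J
  · obtain ⟨J, hJ, hx⟩ := h
    exact Or.inl ⟨J, hJ, hx, Or.inl rfl, by simp⟩
  · exact Or.inr ⟨fun J hJ hx => h ⟨J, hJ, hx⟩, rfl⟩

theorem move_of_mem (hi : i.Mem J) {x y : V} (h : s(x, y) ∈ J) :
    S.Move i ((S.color i J y)⁻¹ * S.color i J x) x y :=
  Or.inl ⟨J, hi, mem_carrier_left h, Or.inr h, by simp⟩

variable [ActsOnGraph G X] {S}

/-- `G` changes colours by left translations and moves change them by right translations. -/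
theorem Move.smul {a : B i} {x y : V} (h : S.Move i a x y) (g : G) :
    S.Move i a (g • x) (g • y) := by
  rcases h with ⟨J, hJ, hx, hxy, hc⟩ | ⟨hx, rfl⟩
  · obtain ⟨b, hb⟩ := S.color_smul hJ g
    exact Or.inl ⟨g • J, hJ.smul g, smul_mem_carrier hx g, hxy.smul g,
      by rw [hb, hb, hc, mul_assoc]⟩
  · refine Or.inr ⟨fun J hJ hgx => hx (g⁻¹ • J) (hJ.smul _) ?_, rfl⟩
    simpa using smul_mem_carrier hgx g⁻¹

variable (S) in
theorem exists_move (hX : IsQuasiMedian X) (hS : IsSpecialAction G X) (a : B i) (x : V) :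
    ∃ y, S.Move i a x y := by
  by_cases h : ∃ J, i.Mem J ∧ x ∈ carrier J
  · obtain ⟨J, hJ, hx⟩ := h
    obtain ⟨u, hu⟩ := S.surjective hJ (S.color i J x * a⁻¹)
    obtain ⟨z, hz, huz⟩ := hJ.1.exists_eqOrMem hX (hS.not_transverse_self hJ.1) hx u
    exact ⟨z, Or.inl ⟨J, hJ, hx, hz, by rw [← hu, (S.color_eq_iff hJ).2 huz]⟩⟩
  · exact ⟨x, Or.inr ⟨fun J hJ hx => h ⟨J, hJ, hx⟩, rfl⟩⟩

theorem Move.unique (hX : IsQuasiMedian X) (hS : IsSpecialAction G X) {a : B i} {x y z : V}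
    (hy : S.Move i a x y) (hz : S.Move i a x z) : y = z := by
  rcases hy with ⟨J, hJ, hx, hxy, hc⟩ | ⟨hx, rfl⟩
  · rcases hz with ⟨J', hJ', hx', hxz, hc'⟩ | ⟨hx', rfl⟩
    · obtain rfl := hJ.eq_of_mem_carrier hS hJ' hx hx'
      exact hxy.eq_of_reachable hX hJ.1 hxz ((S.color_eq_iff hJ).1 (hc.trans hc'.symm))
    · exact absurd hx (hx' J hJ)
  · rcases hz with ⟨J', hJ', hx', -, -⟩ | ⟨-, rfl⟩
    · exact absurd hx' (hx J' hJ')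
    · rfl

/-- Multiplying colours on the right by inverses makes the moves a left action. The second move uses
the same hyperplane, because `y` stays in the carrier of the first. -/
theorem Move.trans (hX : IsQuasiMedian X) (hS : IsSpecialAction G X) {a b : B i} {x y z : V}
    (hy : S.Move i a x y) (hz : S.Move i b y z) : S.Move i (b * a) x z := by
  rcases hy with ⟨J, hJ, hx, hxy, hc⟩ | ⟨hx, rfl⟩
  · have hy := hxy.mem_carrier hx
    rcases hz with ⟨J', hJ', hy', hyz, hc'⟩ | ⟨hy', rfl⟩
    · obtain rfl := hJ.eq_of_mem_carrier hS hJ' hy hy'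
      refine Or.inl ⟨J, hJ, hx, hxy.trans hX hJ.1 (hS.not_transverse_self hJ.1) hyz, ?_⟩
      rw [hc', hc, mul_inv_rev, mul_assoc]
    · exact absurd hy (hy' J hJ)
  · rcases hz with ⟨J', hJ', hy', -, -⟩ | ⟨-, rfl⟩
    · exact absurd hy' (hx J' hJ')
    · exact Or.inr ⟨hx, rfl⟩

variable {hS : IsSpecialAction G X}

/-- An edge of class `i` cannot enter the carrier of a hyperplane of an adjacent class: the square
at its end would put its origin in the carrier too. -/
theorem Move.of_forall_notMem (hX : IsQuasiMedian X) (hij : (HyperplaneClass.graph hS).Adj i j)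
    {a : B i} {x y : V} (hxy : S.Move i a x y) (hx : ∀ J, j.Mem J → x ∉ carrier J) (b : B j) :
    S.Move j b y y := by
  refine Or.inr ⟨fun J₂ h₂ hy => ?_, rfl⟩
  rcases hxy with ⟨J₁, h₁, -, rfl | hxy, -⟩ | ⟨-, rfl⟩
  · exact hx J₂ h₂ hy
  · exact hx J₂ h₂ (HyperplaneClass.mem_carrier_of_adj hX hij h₁ h₂ hxy hy)
  · exact hx J₂ h₂ hy

/-- When both moves are non-trivial, their edges span a square. Its fourth vertex is the common
result, since the sides in one hyperplane do not change the sector of the other. -/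
theorem Move.exists_commute (hX : IsQuasiMedian X) (hij : (HyperplaneClass.graph hS).Adj i j)
    {a : B i} {b : B j} {x y z : V} (hy : S.Move i a x y) (hz : S.Move j b x z) :
    ∃ w, S.Move j b y w ∧ S.Move i a z w := by
  rcases id hz with ⟨J₂, h₂, hx₂, hxz, hcz⟩ | ⟨hx, rfl⟩
  swap
  · exact ⟨y, hy.of_forall_notMem hX hij hx b, hy⟩
  rcases id hy with ⟨J₁, h₁, hx₁, hxy, hcy⟩ | ⟨hx, rfl⟩
  swap
  · exact ⟨z, hz, hz.of_forall_notMem hX hij.symm hx a⟩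
  rcases hxy with rfl | hxy
  · obtain rfl : a = 1 := inv_eq_one.1 (left_eq_mul.1 hcy)
    exact ⟨z, hz, S.move_one i z⟩
  rcases hxz with rfl | hxz
  · obtain rfl : b = 1 := inv_eq_one.1 (left_eq_mul.1 hcz)
    exact ⟨y, S.move_one j y, hy⟩
  obtain ⟨w, hw⟩ := HyperplaneClass.exists_square_of_adj hX hij h₁ h₂ hxy hxz
  have r₁ := IsHyperplane.reachable_of_square (hS.not_transverse_self h₁.1) hw hxy
  have r₂ := IsHyperplane.reachable_of_square (hS.not_transverse_self h₂.1) hw.reflect hxz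
  refine ⟨w, Or.inl ⟨J₂, h₂, ?_, Or.inr ?_, ?_⟩, Or.inl ⟨J₁, h₁, ?_, Or.inr ?_, ?_⟩⟩
  · exact mem_carrier_left (h₂.1.mem_of_square hxz hw.reflect)
  · exact h₂.1.mem_of_square hxz hw.reflect
  · rw [← (S.color_eq_iff h₂).2 r₂.1, ← (S.color_eq_iff h₂).2 r₂.2, hcz]
  · exact mem_carrier_left (h₁.1.mem_of_square hxy hw)
  · exact h₁.1.mem_of_square hxy hw
  · rw [← (S.color_eq_iff h₁).2 r₁.1, ← (S.color_eq_iff h₁).2 r₁.2, hcy]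

theorem exists_vertexGroup_action (hX : IsQuasiMedian X) (hS : IsSpecialAction G X)
    (S : ColorSystem G X B) (i : HyperplaneClass G X) :
    ∃ α : B i →* Equiv.Perm V, ∀ a x y, α a x = y ↔ S.Move i a x y := by
  choose f hf using fun (a : B i) x => S.exists_move hX hS a x
  let F : B i →* Function.End V :=
    { toFun := f
      map_one' := funext fun x => (hf 1 x).unique hX hS (S.move_one i x)
      map_mul' := fun a b => funext fun x =>
        (hf (a * b) x).unique hX hS ((hf b x).trans hX hS (hf a _)) }
  refine ⟨F.toHomPerm, fun a x y => ⟨?_, fun h => (hf a x).unique hX hS h⟩⟩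
  rintro rfl
  exact hf a x

/-- The graph product of the colour groups. -/
abbrev Product (hS : IsSpecialAction G X) (B : HyperplaneClass G X → Type u)
    [∀ i, Group (B i)] :=
  GraphProduct (HyperplaneClass.graph hS) B

/-- The embedding of a vertex-group in the graph product. -/
def inclusion (hS : IsSpecialAction G X) (i : HyperplaneClass G X) : B i →* Product hS B :=
  (QuotientGroup.mk' _).comp Monoid.CoprodI.of

theorem inclusion_commute (hij : (HyperplaneClass.graph hS).Adj i j) (a : B i) (b : B j) :
    inclusion hS i a * inclusion hS j b = inclusion hS j b * inclusion hS i a := by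
  have h : (Monoid.CoprodI.of a * Monoid.CoprodI.of b * (Monoid.CoprodI.of a)⁻¹ *
      (Monoid.CoprodI.of b)⁻¹ : Monoid.CoprodI B) ∈
      Subgroup.normalClosure (graphProductRelators (HyperplaneClass.graph hS) B) :=
    Subgroup.subset_normalClosure ⟨i, j, hij, a, b, rfl⟩
  rw [← QuotientGroup.eq_one_iff] at h
  exact mul_inv_eq_iff_eq_mul.1 (mul_inv_eq_one.1 h)

/-- The vertex-group actions extend to the free product, and `Move.exists_commute` kills the
relators. -/
theorem exists_action (hX : IsQuasiMedian X) (hS : IsSpecialAction G X) (S : ColorSystem G X B) :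
    ∃ α : Product hS B →* Equiv.Perm V, (∀ a (g : G) x, α a (g • x) = g • α a x) ∧
      ∀ i (a : B i) x y, S.Move i a x y → α (inclusion hS i a) x = y := by
  choose β hβ using S.exists_vertexGroup_action hX hS
  let α₀ := Monoid.CoprodI.lift β
  have hα₀ : ∀ i (a : B i), α₀ (Monoid.CoprodI.of a) = β i a := fun i a =>
    Monoid.CoprodI.lift_of ..
  have hker : Subgroup.normalClosure (graphProductRelators (HyperplaneClass.graph hS) B) ≤
      α₀.ker := by
    refine Subgroup.normalClosure_le_normal ?_
    rintro _ ⟨i, j, hij, a, b, rfl⟩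
    refine MonoidHom.mem_ker.2 ?_
    simp only [map_mul, map_inv, hα₀]
    rw [mul_inv_eq_one, mul_inv_eq_iff_eq_mul]
    ext x
    obtain ⟨w, hw₁, hw₂⟩ := ((hβ i a x _).1 rfl).exists_commute hX hij ((hβ j b x _).1 rfl)
    rw [Equiv.Perm.mul_apply, Equiv.Perm.mul_apply, (hβ j b _ _).2 hw₁, (hβ i a _ _).2 hw₂]
  refine ⟨QuotientGroup.lift _ α₀ hker, fun a g => ?_, fun i a x y h => ?_⟩
  · induction a using QuotientGroup.induction_on with
    | _ a =>
      change ∀ x, α₀ a (g • x) = g • α₀ a x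
      induction a using Monoid.CoprodI.induction_on with
      | one => simp
      | of i a =>
        intro x
        rw [hα₀]
        exact (hβ i a _ _).2 (((hβ i a x _).1 rfl).smul g)
      | mul a b iha ihb =>
        intro x
        rw [map_mul, Equiv.Perm.mul_apply, Equiv.Perm.mul_apply, ihb, iha]
  · change α₀ (Monoid.CoprodI.of a) x = y
    rw [hα₀]
    exact (hβ i a x y).2 h

variable (S) in
theorem exists_label (hS : IsSpecialAction G X) :
    ∃ l : V → V → Product hS B, ∀ i J x y, i.Mem J → s(x, y) ∈ J →
      l x y = inclusion hS i ((S.color i J y)⁻¹ * S.color i J x) := by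
  have h : ∀ x y, ∃ v : Product hS B, ∀ i J, i.Mem J → s(x, y) ∈ J →
      v = inclusion hS i ((S.color i J y)⁻¹ * S.color i J x) := by
    intro x y
    by_cases h : ∃ (i : HyperplaneClass G X) (J : _), i.Mem J ∧ s(x, y) ∈ J
    · obtain ⟨i, J, hJ, hxy⟩ := h
      refine ⟨inclusion hS i ((S.color i J y)⁻¹ * S.color i J x), fun j K hK hxy' => ?_⟩
      obtain rfl := hJ.1.eq_of_mem hK.1 hxy hxy'
      obtain rfl := hJ.eq hK
      rfl
    -- Pairs that are not edges receive the irrelevant label `1`.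
    · exact ⟨1, fun i J hJ hxy => absurd ⟨i, J, hJ, hxy⟩ h⟩
  choose l hl using h
  exact ⟨l, fun i J x y => hl x y i J⟩

theorem exists_virtualRetract (hX : IsQuasiMedian X) (hS : IsSpecialAction G X)
    (hfin : Finite (MulAction.orbitRel.Quotient G V)) (S : ColorSystem G X B) :
    ∃ φ : G →* Product hS B, Function.Injective φ ∧ IsVirtualRetract φ.range := by
  obtain ⟨α, hαG, hα⟩ := S.exists_action hX hS
  obtain ⟨l, hl⟩ := S.exists_label hS
  have hedge : ∀ {x y}, X.Adj x y → ∃ (i : HyperplaneClass G X) (J : _),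
      i.Mem J ∧ s(x, y) ∈ J := by
    intro x y h
    obtain ⟨J, hJ, hxy⟩ := exists_isHyperplane_mem h
    obtain ⟨i, hi⟩ := HyperplaneClass.exists_mem_of_isHyperplane G hJ
    exact ⟨i, J, hi, hxy⟩
  refine exists_virtualRetract_of_cocycle hX (fun g x => hS.free hX) hfin α hαG (l := l)
    ⟨?_, ?_, ?_⟩ ?_ ?_
  · intro x y h
    obtain ⟨i, J, hi, hxy⟩ := hedge h
    rw [hl i J x y hi hxy, hl i J y x hi (by rwa [Sym2.eq_swap]), ← map_mul]
    simp
  · intro x y z hxy hyz hxz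
    obtain ⟨i, J, hi, hxyJ⟩ := hedge hxy
    have hyzJ := hi.1.mem_of_triangle hxyJ hxz hyz
    have hxzJ : s(x, z) ∈ J := hi.1.mem_of_triangle (by rwa [Sym2.eq_swap]) hyz hxz
    rw [hl i J x y hi hxyJ, hl i J y z hi hyzJ, hl i J x z hi hxzJ, ← map_mul]
    simp [mul_assoc]
  · intro a b c d hs
    obtain ⟨i, J₁, h₁, hab⟩ := hedge hs.adj_ab
    obtain ⟨j, J₂, h₂, hbc⟩ := hedge hs.adj_bc
    have hdc := h₁.1.mem_of_square hab hs
    have had : s(a, d) ∈ J₂ := h₂.1.mem_of_square hbc hs.rotate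
    have r₁ := IsHyperplane.reachable_of_square (hS.not_transverse_self h₁.1) hs hab
    have r₂ := IsHyperplane.reachable_of_square (hS.not_transverse_self h₂.1) hs.reflect had
    rw [hl i J₁ a b h₁ hab, hl j J₂ b c h₂ hbc, hl i J₁ d c h₁ hdc, hl j J₂ a d h₂ had,
      (S.color_eq_iff h₁).2 r₁.1, (S.color_eq_iff h₁).2 r₁.2, (S.color_eq_iff h₂).2 r₂.1,
      (S.color_eq_iff h₂).2 r₂.2]
    -- Opposite sides now carry equal labels, and the two labels come from adjacent classes.
    exact (inclusion_commute ⟨J₁, J₂, h₁, h₂, a, b, c, d, hs, hab, hbc⟩ _ _).symm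
  · intro x y h
    obtain ⟨i, J, hi, hxy⟩ := hedge h
    rw [hl i J x y hi hxy]
    exact hα i _ x y (S.move_of_mem hi hxy)
  · intro g x y h
    obtain ⟨i, J, hi, hxy⟩ := hedge h
    obtain ⟨b, hb⟩ := S.color_smul hi g
    rw [hl i J x y hi hxy, hl i (g • J) _ _ (hi.smul g) ((mk_smul_mem_smul_iff g).2 hxy), hb, hb]
    congr 1
    -- The left factor `b` cancels in the quotient of two colours.
    group

end ColorSystem

end ColorSystems

end QM

theorem theorem1p1 {G : Type u} [Group G] {V : Type v} (X : SimpleGraph V)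
    [MulAction G V] [QM.ActsOnGraph G X]
    (hX : QM.IsQuasiMedian X)
    (hspecial : QM.IsSpecialAction G X)
    (hfin : Finite (MulAction.orbitRel.Quotient G V)) :
    ∃ (I : Type v) (Γ : SimpleGraph I) (𝒢 : I → Type u) (_ : ∀ i, Group (𝒢 i)),
      (∀ i, Nontrivial (𝒢 i)) ∧
      (∀ i, ∃ C : Set V, Maximal X.IsClique C ∧
        QM.IsFiniteExtension (𝒢 i) (MulAction.stabilizer G C)) ∧
      ∃ φ : G →* QM.GraphProduct Γ 𝒢,
        Function.Injective φ ∧ QM.IsVirtualRetract φ.range := by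
  obtain ⟨B, hB, hnt, hfe, ⟨S⟩⟩ := hspecial.exists_colorSystem hX hfin
  exact ⟨QM.HyperplaneClass G X, QM.HyperplaneClass.graph hspecial, B, hB, hnt, hfe,
    S.exists_virtualRetract hX hspecial hfin⟩
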